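/- **Conventions.** A *polynomial* $p=\sum_{I\in p(1)}\mathcal{y}^{p[I]}$ consists of a set $p(1)$ of positions and, for each $I\in p(1)$, a set $p[I]$ of directions. A morphism $p\to q$ is a natural transformation of the associated functors $\mathbf{Set}\to\mathbf{Set}$, i.e. a function $\phi_1\colon p(1)\to q(1)$ with functions $q[\phi_1 I]\to p[I]$ for $I\in p(1)$. The category $\mathbf{Poly}$ is monoidal under composition $\triangleleft$, with unit $\mathcal{y}$ (one position, one direction). A *comonoid* $(c,\epsilon_c,\delta_c)$ is a comonoid in $(\mathbf{Poly},\triangleleft,\mathcal{y})$ (equivalently, a small category); it is *nonempty* if $c(1)\neq\emptyset$. Write $0$ for the empty comonoid and $\mathcal{y}$ for the unit comonoid. * $\mathbb{C}\mathbf{at}^\sharp$ is the pseudo-double category with comonoids as objects, comonoid homomorphisms as vertical morphisms, and as horizontal morphisms from $c$ to $d$ the $(c,d)$-bicomodules $c\triangleleft p\leftarrow p\to p\triangleleft d$. Squares from $p$ to $p'$ over $(\alpha,\beta)$ are morphisms $p\to p'$ of polynomials commuting with the coactions. The composite $p\triangleleft_d q$ is the equalizer of the two maps $p\triangleleft q\rightrightarrows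 p\triangleleft d\triangleleft q$, and the horizontal identity on $c$ is $c$ with its comultiplication. * A *$(c,d)$-effects handler* is a polynomial $s$ with a morphism $\varphi\colon s\triangleleft d\to c\triangleleft s$ such that $(\epsilon_c\triangleleft s)\circ\varphi=s\triangleleft\epsilon_d$ and $(\delta_c\triangleleft s)\circ\varphi=(c\triangleleft\varphi)\circ(\varphi\triangleleft d)\circ(s\triangleleft\delta_d)$. $\mathbb{E}\mathbf{ff}$ is the pseudo-double category with the same objects and vertical morphisms, and with the $(c,d)$-effects handlers as horizontal morphisms from $c$ to $d$. Squares from $(s,\varphi)$ to $(s',\varphi')$ over $\alpha\colon c\to c'$, $\beta\colon d\to d'$ are the morphisms $\gamma\colon s\to s'$ with $(\alpha\triangleleft\gamma)\circ\varphi=\varphi'\circ(\gamma\triangleleft\beta)$. The composite of $(s,\varphi)$ and $(t,\psi)$ is $s\triangleleft t$ with structure map $s\triangleleft t\triangleleft e\to s\triangleleft d\triangleleft t\to c\triangleleft s\triangleleft t$, and the horizontal identity is carried by $\mathcal{y}$. **Theorem.** There is a pseudo-double functor $F\colon\mathbb{E}\mathbf{ff}\to\mathbb{C}\mathbf{at}^\sharp$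 such that: 1. $F$ is the identity on objects and vertical morphisms. It sends a $(c,d)$-effects handler $(s,\varphi)$ to the $(c,d)$-bicomodule $s\triangleleft d$ with coactions $$c\triangleleft s\triangleleft d\xleftarrow{\ \varphi\triangleleft d\ }s\triangleleft d\triangleleft d\xleftarrow{\ s\triangleleft\delta_d\ }s\triangleleft d\xrightarrow{\ s\triangleleft\delta_d\ }s\triangleleft d\triangleleft d,$$ and a square $\gamma$ over $(\alpha,\beta)$ to $\gamma\triangleleft\beta$. 2. $F$ is faithful on the category of horizontal morphisms between nonempty comonoids and squares between them: if $c,d,c',d'$ are nonempty, then for all effects handlers $s$ from $c$ to $d$ and $s'$ from $c'$ to $d'$, $F$ is injective on the squares from $s$ to $s'$. 3. For every comonoid $c$, every $(c,0)$-bicomodule and every $(c,\mathcal{y})$-bicomodule is isomorphic, as a bicomodule, to $F(s,\varphi)$ for some $(c,0)$-effects handler, respectively $(c,\mathcal{y})$-effects handler, $(s,\varphi)$. -/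

import Mathlib

open CategoryTheory MonoidalCategory Limits
open scoped ComonObj

universe u v w x u' v' w' x'

/-- Tensoring with an object, on either side, preserves equalizers. -/
class TensorPreservesEqualizers (C : Type u) [Category.{v} C] [MonoidalCategory C] : Prop where
  left (X : C) {A B : C} (f g : A ⟶ B) : PreservesLimit (parallelPair f g) (tensorLeft X)
  right (X : C) {A B : C} (f g : A ⟶ B) : PreservesLimit (parallelPair f g) (tensorRight X)

/-! ## Polynomials in one variable

All sets are in `Type u`. The set `p(1)` of positions of a polynomial `p` is `p.A`, and the set
`p[I]` of directions at a position `I` is `p.B I`. -/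

/-- A polynomial `p = ∑ I : p(1), y ^ p[I]`. -/
abbrev PolyCat : Type (u + 1) := PFunctor.{u, u}

namespace PolyCat

/-- A morphism of polynomials `φ : p → q`: a function `φ₁ : p(1) → q(1)` on positions, and for each
position `I` of `p` a function `q[φ₁ I] → p[I]` on directions. -/
@[ext]
structure Hom (p q : PolyCat.{u}) : Type u where
  onPos : p.A → q.A
  onDir : ∀ I : p.A, q.B (onPos I) → p.B I

/-- The category of polynomials. -/
instance category : Category.{u} PolyCat.{u} where
  Hom := Hom
  id _ := ⟨fun I => I, fun _ i => i⟩
  comp φ ψ := ⟨fun I => ψ.onPos (φ.onPos I), fun I k => φ.onDir I (ψ.onDir (φ.onPos I) k)⟩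

/-- The polynomial `y`, with one position and one direction. -/
def unit : PolyCat.{u} := ⟨PUnit, fun _ => PUnit⟩

/-- The monoidal structure `(y, ◁)` given by composition of polynomials: a position of `p ◁ q` is a
position `I` of `p` with a function `J : p[I] → q(1)`, and a direction at it is an `i : p[I]` with
an element of `q[J i]`. Mathlib writes `⊗` for this tensor product. -/
instance monoidal : MonoidalCategory PolyCat.{u} where
  tensorObj p q := PFunctor.comp p q
  tensorUnit := unit
  tensorHom φ ψ :=
    ⟨fun K => ⟨φ.onPos K.1, fun i => ψ.onPos (K.2 (φ.onDir K.1 i))⟩,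
      fun K k => ⟨φ.onDir K.1 k.1, ψ.onDir (K.2 (φ.onDir K.1 k.1)) k.2⟩⟩
  whiskerLeft _ _ _ ψ :=
    ⟨fun K => ⟨K.1, fun i => ψ.onPos (K.2 i)⟩, fun K k => ⟨k.1, ψ.onDir (K.2 k.1) k.2⟩⟩
  whiskerRight φ _ :=
    ⟨fun K => ⟨φ.onPos K.1, fun i => K.2 (φ.onDir K.1 i)⟩,
      fun K k => ⟨φ.onDir K.1 k.1, k.2⟩⟩
  associator _ _ _ :=
    { hom := ⟨fun K => ⟨K.1.1, fun i => ⟨K.1.2 i, fun j => K.2 ⟨i, j⟩⟩⟩,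
        fun _ k => ⟨⟨k.1, k.2.1⟩, k.2.2⟩⟩
      inv := ⟨fun K => ⟨⟨K.1, fun i => (K.2 i).1⟩, fun k => (K.2 k.1).2 k.2⟩,
        fun _ k => ⟨k.1.1, k.1.2, k.2⟩⟩
      hom_inv_id := rfl
      inv_hom_id := rfl }
  leftUnitor _ :=
    { hom := ⟨fun K => K.2 PUnit.unit, fun _ i => ⟨PUnit.unit, i⟩⟩
      inv := ⟨fun I => ⟨PUnit.unit, fun _ => I⟩, fun _ k => k.2⟩
      hom_inv_id := rfl
      inv_hom_id := rfl }
  rightUnitor _ :=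
    { hom := ⟨fun K => K.1, fun _ i => ⟨i, PUnit.unit⟩⟩
      inv := ⟨fun I => ⟨I, fun _ => PUnit.unit⟩, fun _ k => k.1⟩
      hom_inv_id := rfl
      inv_hom_id := rfl }
  tensorHom_def _ _ := rfl
  id_tensorHom_id _ _ := rfl
  tensorHom_comp_tensorHom _ _ _ _ := rfl
  whiskerLeft_id _ _ := rfl
  id_whiskerRight _ _ := rfl
  associator_naturality _ _ _ := rfl
  leftUnitor_naturality _ := rfl
  rightUnitor_naturality _ := rfl
  pentagon _ _ _ _ := rfl
  triangle _ _ := rfl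

/-- The component at a set `X` of the natural transformation `p(X) → q(X)` given by `φ`. -/
def Hom.app {p q : PolyCat.{u}} (φ : p ⟶ q) {X : Type u} (y : p X) : q X :=
  ⟨φ.onPos y.1, fun k => y.2 (φ.onDir y.1 k)⟩

/-- `ι` is an equalizer of `f` and `g` after evaluation at each set. -/
def IsPointwiseEqualizer {e a b : PolyCat.{u}} (ι : e ⟶ a) (f g : a ⟶ b) : Prop :=
  ∀ (X : Type u) (y : a X), Hom.app f y = Hom.app g y → ∃! z : e X, Hom.app ι z = y

theorem hom_ext_app {p q : PolyCat.{u}} {φ ψ : p ⟶ q}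
    (h : ∀ I : p.A, Hom.app φ (⟨I, id⟩ : p (p.B I)) = Hom.app ψ ⟨I, id⟩) : φ = ψ := by
  obtain ⟨f, f'⟩ := φ
  obtain ⟨g, g'⟩ := ψ
  have h1 : f = g := funext fun I => congrArg Sigma.fst (h I)
  subst h1
  have h2 : f' = g' := funext fun I => eq_of_heq (Sigma.mk.inj (h I)).2
  rw [h2]

theorem IsPointwiseEqualizer.isLimit {e a b : PolyCat.{u}} {ι : e ⟶ a} {f g : a ⟶ b}
    (w : ι ≫ f = ι ≫ g) (h : IsPointwiseEqualizer ι f g) :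
    Nonempty (IsLimit (Fork.ofι ι w)) := by
  refine ⟨Fork.IsLimit.ofExistsUnique fun s => ?_⟩
  have hs : ∀ I : s.pt.A, ∃! z : e (s.pt.B I),
      Hom.app ι z = Hom.app s.ι (⟨I, id⟩ : s.pt (s.pt.B I)) := by
    intro I
    apply h
    exact congrArg (fun φ : s.pt ⟶ b => Hom.app φ (⟨I, id⟩ : s.pt (s.pt.B I))) s.condition
  choose z hz hu using hs
  refine ⟨⟨fun I => (z I).1, fun I => (z I).2⟩, ?_, ?_⟩
  · exact hom_ext_app fun I => hz I
  · intro m hm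
    apply hom_ext_app
    intro I
    apply hu
    exact congrArg (fun φ : s.pt ⟶ a => Hom.app φ (⟨I, id⟩ : s.pt (s.pt.B I))) hm

section
variable {a b : PolyCat.{u}} (f g : a ⟶ b)

/-- The relation on directions of `a` to be divided out in the equalizer of `f` and `g`. -/
inductive EqualizerRel (I : { I : a.A // f.onPos I = g.onPos I }) : a.B I.1 → a.B I.1 → Prop
  | intro (k : b.B (f.onPos I.1)) (k' : b.B (g.onPos I.1)) (h : HEq k k') :
      EqualizerRel I (f.onDir I.1 k) (g.onDir I.1 k')

/-- The equalizer of `f` and `g`. -/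
def equalizerObj : PolyCat.{u} :=
  ⟨{ I : a.A // f.onPos I = g.onPos I }, fun I => Quot (EqualizerRel f g I)⟩

/-- The inclusion of the equalizer of `f` and `g`. -/
def equalizerHom : equalizerObj f g ⟶ a :=
  ⟨fun I => I.1, fun _ i => Quot.mk _ i⟩

theorem equalizerHom_isPointwiseEqualizer : IsPointwiseEqualizer (equalizerHom f g) f g := by
  rintro X ⟨I, h⟩ e
  have e1 : f.onPos I = g.onPos I := congrArg Sigma.fst e
  have e2 : ∀ k k', HEq k k' → h (f.onDir I k) = h (g.onDir I k') := by
    have e3 := (Sigma.mk.inj e).2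
    intro k k' hk
    have e4 := congr_heq e3 hk
    exact e4
  refine ⟨⟨⟨I, e1⟩, Quot.lift h ?_⟩, rfl, ?_⟩
  · rintro _ _ ⟨k, k', hk⟩
    exact e2 k k' hk
  · rintro ⟨⟨I', e'⟩, h'⟩ hh
    obtain ⟨rfl, hh⟩ := Sigma.mk.inj hh
    have := eq_of_heq hh
    subst this
    congr 1
    funext i
    induction i using Quot.ind
    rfl

theorem equalizerHom_condition : equalizerHom f g ≫ f = equalizerHom f g ≫ g := by
  have key : ∀ I : (equalizerObj f g).A,
      (⟨f.onPos I.1, fun k => Quot.mk _ (f.onDir I.1 k)⟩ : b ((equalizerObj f g).B I)) =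
        ⟨g.onPos I.1, fun k => Quot.mk _ (g.onDir I.1 k)⟩ := by
    intro I
    refine Sigma.ext I.2 (Function.hfunext (congrArg b.B I.2) ?_)
    intro k k' hk
    exact heq_of_eq (Quot.sound (EqualizerRel.intro (I := I) k k' hk))
  exact hom_ext_app key

end

theorem IsPointwiseEqualizer.whiskerLeft {e a b : PolyCat.{u}} {ι : e ⟶ a} {f g : a ⟶ b}
    (h : IsPointwiseEqualizer ι f g) (c : PolyCat.{u}) :
    IsPointwiseEqualizer (c ◁ ι) (c ◁ f) (c ◁ g) := by
  rintro X ⟨⟨I, J⟩, k⟩ hy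
  have h2 : ∀ i : c.B I, Hom.app f (⟨J i, fun j => k ⟨i, j⟩⟩ : a X) =
      Hom.app g ⟨J i, fun j => k ⟨i, j⟩⟩ := fun i =>
    congrFun (eq_of_heq (Sigma.mk.inj
      (congrArg (PFunctor.comp.get c b) hy)).2) i
  choose z hz hu using fun i => h X _ (h2 i)
  refine ⟨⟨⟨I, fun i => (z i).1⟩, fun l => (z l.1).2 l.2⟩, ?_, ?_⟩
  · exact congrArg (fun t : c.B I → a X => (PFunctor.comp.mk c a ⟨I, t⟩ : (c ⊗ a : PolyCat.{u}) X))
      (funext hz)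
  · rintro ⟨⟨I', J'⟩, k'⟩ hh
    have h3 := congrArg (PFunctor.comp.get c a) hh
    obtain ⟨h4, h5⟩ := Sigma.mk.inj h3
    cases h4
    have h6 := fun i => congrFun (eq_of_heq h5) i
    have h7 := fun i => hu i ⟨J' i, fun j => k' ⟨i, j⟩⟩ (h6 i)
    exact congrArg (fun t : c.B I → e X => (PFunctor.comp.mk c e ⟨I, t⟩ : (c ⊗ e : PolyCat.{u}) X))
      (funext h7)

theorem IsPointwiseEqualizer.whiskerRight {e a b : PolyCat.{u}} {ι : e ⟶ a} {f g : a ⟶ b}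
    (h : IsPointwiseEqualizer ι f g) (c : PolyCat.{u}) :
    IsPointwiseEqualizer (ι ▷ c) (f ▷ c) (g ▷ c) := by
  intro X y hy
  obtain ⟨z, hz, hu⟩ := h (c X) (PFunctor.comp.get a c y) (congrArg (PFunctor.comp.get b c) hy)
  refine ⟨PFunctor.comp.mk e c z, congrArg (PFunctor.comp.mk a c) hz, ?_⟩
  intro z' hz'
  exact congrArg (PFunctor.comp.mk e c)
    (hu (PFunctor.comp.get e c z') (congrArg (PFunctor.comp.get a c) hz'))

instance : HasEqualizers PolyCat.{u} :=
  @hasEqualizers_of_hasLimit_parallelPair _ _ (fun {_ _ f g} =>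
    HasLimit.mk ⟨_, (IsPointwiseEqualizer.isLimit (equalizerHom_condition f g)
      (equalizerHom_isPointwiseEqualizer f g)).some⟩)

instance : TensorPreservesEqualizers PolyCat.{u} where
  left c a b f g := by
    have w := equalizerHom_condition f g
    have h := equalizerHom_isPointwiseEqualizer f g
    refine preservesLimit_of_preserves_limit_cone (h.isLimit w).some ?_
    exact (isLimitMapConeForkEquiv (tensorLeft c) w).symm ((h.whiskerLeft c).isLimit _).some
  right c a b f g := by
    have w := equalizerHom_condition f g
    have h := equalizerHom_isPointwiseEqualizer f g
    refine preservesLimit_of_preserves_limit_cone (h.isLimit w).some ?_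
    exact (isLimitMapConeForkEquiv (tensorRight c) w).symm ((h.whiskerRight c).isLimit _).some

/-- The comonoid `0` (the empty category), with no positions. -/
def emptyComon : Comon PolyCat.{u} where
  X := ⟨PEmpty, fun x => x.elim⟩
  comon :=
    { counit := ⟨fun x => x.elim, fun x => x.elim⟩
      comul := ⟨fun x => x.elim, fun x => x.elim⟩
      counit_comul := hom_ext_app fun x => x.elim
      comul_counit := hom_ext_app fun x => x.elim
      comul_assoc := hom_ext_app fun x => x.elim }

end PolyCat

/-! ## Pseudo-double categories

Horizontal composition is written in diagrammatic order. Vertical composition of squares is strictly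
unital and associative; since the vertical boundaries of the two sides of such an equation agree
only up to a provable equality, equations between squares are stated with `HEq`. -/

/-- The vertical part of a pseudo-double category: a category of objects and vertical morphisms,
a category of horizontal morphisms and squares, and source and target functors from the second to
the first. `Sq p p' f g` is the type of squares with horizontal source `p`, horizontal target `p'`,
left vertical side `f` and right vertical side `g`; `vid` and `vcomp` are the identities and the
composition of the category of horizontal morphisms and squares. -/
structure DoubleBase where
  Obj : Type u
  [cat : Category.{v} Obj]
  Hor : Obj → Obj → Type w
  Sq : ∀ {a b a' b' : Obj}, Hor a b → Hor a' b' → (a ⟶ a') → (b ⟶ b') → Type x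
  vid : ∀ {a b : Obj} (p : Hor a b), Sq p p (𝟙 a) (𝟙 b)
  vcomp : ∀ {a b a' b' a'' b'' : Obj} {p : Hor a b} {p' : Hor a' b'} {p'' : Hor a'' b''}
    {f : a ⟶ a'} {g : b ⟶ b'} {f' : a' ⟶ a''} {g' : b' ⟶ b''},
    Sq p p' f g → Sq p' p'' f' g' → Sq p p'' (f ≫ f') (g ≫ g')
  vid_vcomp : ∀ {a b a' b' : Obj} {p : Hor a b} {p' : Hor a' b'} {f : a ⟶ a'} {g : b ⟶ b'}
    (σ : Sq p p' f g), HEq (vcomp (vid p) σ) σ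
  vcomp_vid : ∀ {a b a' b' : Obj} {p : Hor a b} {p' : Hor a' b'} {f : a ⟶ a'} {g : b ⟶ b'}
    (σ : Sq p p' f g), HEq (vcomp σ (vid p')) σ
  vcomp_assoc : ∀ {a₀ b₀ a₁ b₁ a₂ b₂ a₃ b₃ : Obj} {p₀ : Hor a₀ b₀} {p₁ : Hor a₁ b₁}
    {p₂ : Hor a₂ b₂} {p₃ : Hor a₃ b₃} {f₁ : a₀ ⟶ a₁} {g₁ : b₀ ⟶ b₁} {f₂ : a₁ ⟶ a₂}
    {g₂ : b₁ ⟶ b₂} {f₃ : a₂ ⟶ a₃} {g₃ : b₂ ⟶ b₃}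
    (σ : Sq p₀ p₁ f₁ g₁) (τ : Sq p₁ p₂ f₂ g₂) (υ : Sq p₂ p₃ f₃ g₃),
    HEq (vcomp (vcomp σ τ) υ) (vcomp σ (vcomp τ υ))

attribute [instance] DoubleBase.cat

namespace DoubleBase

/-- An invertible globular square: an isomorphism of horizontal morphisms from `a` to `b` whose
vertical sides are identities. -/
structure GlobIso (D : DoubleBase.{u, v, w, x}) {a b : D.Obj} (p q : D.Hor a b) where
  hom : D.Sq p q (𝟙 a) (𝟙 b)
  inv : D.Sq q p (𝟙 a) (𝟙 b)
  hom_inv : HEq (D.vcomp hom inv) (D.vid p)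
  inv_hom : HEq (D.vcomp inv hom) (D.vid q)

/-- All squares from `p` to `p'`, with arbitrary vertical sides: the morphisms from `p` to `p'` in
the category of horizontal morphisms and squares. -/
def Mor (D : DoubleBase.{u, v, w, x}) {a b a' b' : D.Obj} (p : D.Hor a b) (p' : D.Hor a' b') :
    Type (max v x) :=
  Σ (f : a ⟶ a') (g : b ⟶ b'), D.Sq p p' f g

end DoubleBase

/-- A pseudo-double category: horizontal identities and horizontal composition are functorial for
vertical composition, and are unital and associative up to natural invertible globular squares that
satisfy the pentagon and triangle equations. -/
structure PseudoDoubleCat extends DoubleBase.{u, v, w, x} where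
  hid : ∀ a : Obj, Hor a a
  hidSq : ∀ {a a' : Obj} (f : a ⟶ a'), Sq (hid a) (hid a') f f
  hidSq_id : ∀ a : Obj, hidSq (𝟙 a) = vid (hid a)
  hidSq_comp : ∀ {a a' a'' : Obj} (f : a ⟶ a') (f' : a' ⟶ a''),
    hidSq (f ≫ f') = vcomp (hidSq f) (hidSq f')
  hcomp : ∀ {a b c : Obj}, Hor a b → Hor b c → Hor a c
  hcompSq : ∀ {a b c a' b' c' : Obj} {p : Hor a b} {q : Hor b c} {p' : Hor a' b'} {q' : Hor b' c'}
    {f : a ⟶ a'} {g : b ⟶ b'} {h : c ⟶ c'},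
    Sq p p' f g → Sq q q' g h → Sq (hcomp p q) (hcomp p' q') f h
  hcompSq_vid : ∀ {a b c : Obj} (p : Hor a b) (q : Hor b c),
    hcompSq (vid p) (vid q) = vid (hcomp p q)
  hcompSq_vcomp : ∀ {a b c a' b' c' a'' b'' c'' : Obj} {p : Hor a b} {q : Hor b c}
    {p' : Hor a' b'} {q' : Hor b' c'} {p'' : Hor a'' b''} {q'' : Hor b'' c''}
    {f : a ⟶ a'} {g : b ⟶ b'} {h : c ⟶ c'} {f' : a' ⟶ a''} {g' : b' ⟶ b''} {h' : c' ⟶ c''}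
    (σ : Sq p p' f g) (τ : Sq q q' g h) (σ' : Sq p' p'' f' g') (τ' : Sq q' q'' g' h'),
    hcompSq (vcomp σ σ') (vcomp τ τ') = vcomp (hcompSq σ τ) (hcompSq σ' τ')
  assoc : ∀ {a b c d : Obj} (p : Hor a b) (q : Hor b c) (r : Hor c d),
    toDoubleBase.GlobIso (hcomp (hcomp p q) r) (hcomp p (hcomp q r))
  leftUnitor : ∀ {a b : Obj} (p : Hor a b), toDoubleBase.GlobIso (hcomp (hid a) p) p
  rightUnitor : ∀ {a b : Obj} (p : Hor a b), toDoubleBase.GlobIso (hcomp p (hid b)) p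
  assoc_naturality : ∀ {a b c d a' b' c' d' : Obj} {p : Hor a b} {q : Hor b c} {r : Hor c d}
    {p' : Hor a' b'} {q' : Hor b' c'} {r' : Hor c' d'}
    {f : a ⟶ a'} {g : b ⟶ b'} {h : c ⟶ c'} {k : d ⟶ d'}
    (σ : Sq p p' f g) (τ : Sq q q' g h) (υ : Sq r r' h k),
    HEq (vcomp (hcompSq (hcompSq σ τ) υ) (assoc p' q' r').hom)
      (vcomp (assoc p q r).hom (hcompSq σ (hcompSq τ υ)))
  leftUnitor_naturality : ∀ {a b a' b' : Obj} {p : Hor a b} {p' : Hor a' b'}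
    {f : a ⟶ a'} {g : b ⟶ b'} (σ : Sq p p' f g),
    HEq (vcomp (hcompSq (hidSq f) σ) (leftUnitor p').hom) (vcomp (leftUnitor p).hom σ)
  rightUnitor_naturality : ∀ {a b a' b' : Obj} {p : Hor a b} {p' : Hor a' b'}
    {f : a ⟶ a'} {g : b ⟶ b'} (σ : Sq p p' f g),
    HEq (vcomp (hcompSq σ (hidSq g)) (rightUnitor p').hom) (vcomp (rightUnitor p).hom σ)
  pentagon : ∀ {a b c d e : Obj} (p : Hor a b) (q : Hor b c) (r : Hor c d) (s : Hor d e),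
    HEq (vcomp (vcomp (hcompSq (assoc p q r).hom (vid s)) (assoc p (hcomp q r) s).hom)
        (hcompSq (vid p) (assoc q r s).hom))
      (vcomp (assoc (hcomp p q) r s).hom (assoc p q (hcomp r s)).hom)
  triangle : ∀ {a b c : Obj} (p : Hor a b) (q : Hor b c),
    HEq (vcomp (assoc p (hid b) q).hom (hcompSq (vid p) (leftUnitor q).hom))
      (hcompSq (rightUnitor p).hom (vid q))

/-- A pseudo-double functor from `D` to `E` whose underlying functor on objects and vertical
morphisms is `V`. It is functorial for vertical composition of squares, and preserves horizontal
identities and composites up to natural invertible globular squares that are compatible with the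
associators and unitors. -/
structure PseudoDoubleFunctor (D : PseudoDoubleCat.{u, v, w, x})
    (E : PseudoDoubleCat.{u', v', w', x'}) (V : D.Obj ⥤ E.Obj) where
  hor : ∀ {a b : D.Obj}, D.Hor a b → E.Hor (V.obj a) (V.obj b)
  sq : ∀ {a b a' b' : D.Obj} {p : D.Hor a b} {p' : D.Hor a' b'} {f : a ⟶ a'} {g : b ⟶ b'},
    D.Sq p p' f g → E.Sq (hor p) (hor p') (V.map f) (V.map g)
  sq_vid : ∀ {a b : D.Obj} (p : D.Hor a b), HEq (sq (D.vid p)) (E.vid (hor p))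
  sq_vcomp : ∀ {a b a' b' a'' b'' : D.Obj} {p : D.Hor a b} {p' : D.Hor a' b'}
    {p'' : D.Hor a'' b''} {f : a ⟶ a'} {g : b ⟶ b'} {f' : a' ⟶ a''} {g' : b' ⟶ b''}
    (σ : D.Sq p p' f g) (σ' : D.Sq p' p'' f' g'),
    HEq (sq (D.vcomp σ σ')) (E.vcomp (sq σ) (sq σ'))
  unitIso : ∀ a : D.Obj, E.GlobIso (E.hid (V.obj a)) (hor (D.hid a))
  unitIso_naturality : ∀ {a a' : D.Obj} (f : a ⟶ a'),
    HEq (E.vcomp (E.hidSq (V.map f)) (unitIso a').hom)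
      (E.vcomp (unitIso a).hom (sq (D.hidSq f)))
  compIso : ∀ {a b c : D.Obj} (p : D.Hor a b) (q : D.Hor b c),
    E.GlobIso (E.hcomp (hor p) (hor q)) (hor (D.hcomp p q))
  compIso_naturality : ∀ {a b c a' b' c' : D.Obj} {p : D.Hor a b} {q : D.Hor b c}
    {p' : D.Hor a' b'} {q' : D.Hor b' c'} {f : a ⟶ a'} {g : b ⟶ b'} {h : c ⟶ c'}
    (σ : D.Sq p p' f g) (τ : D.Sq q q' g h),
    HEq (E.vcomp (E.hcompSq (sq σ) (sq τ)) (compIso p' q').hom)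
      (E.vcomp (compIso p q).hom (sq (D.hcompSq σ τ)))
  map_assoc : ∀ {a b c d : D.Obj} (p : D.Hor a b) (q : D.Hor b c) (r : D.Hor c d),
    HEq (E.vcomp (E.vcomp (E.hcompSq (compIso p q).hom (E.vid (hor r)))
        (compIso (D.hcomp p q) r).hom) (sq (D.assoc p q r).hom))
      (E.vcomp (E.vcomp (E.assoc (hor p) (hor q) (hor r)).hom
        (E.hcompSq (E.vid (hor p)) (compIso q r).hom)) (compIso p (D.hcomp q r)).hom)
  map_leftUnitor : ∀ {a b : D.Obj} (p : D.Hor a b),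
    HEq (E.vcomp (E.vcomp (E.hcompSq (unitIso a).hom (E.vid (hor p)))
        (compIso (D.hid a) p).hom) (sq (D.leftUnitor p).hom))
      (E.leftUnitor (hor p)).hom
  map_rightUnitor : ∀ {a b : D.Obj} (p : D.Hor a b),
    HEq (E.vcomp (E.vcomp (E.hcompSq (E.vid (hor p)) (unitIso b).hom)
        (compIso p (D.hid b)).hom) (sq (D.rightUnitor p).hom))
      (E.rightUnitor (hor p)).hom

/-- The action of a pseudo-double functor on morphisms of the category of horizontal morphisms and
squares. -/
def PseudoDoubleFunctor.mapMor {D : PseudoDoubleCat.{u, v, w, x}}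
    {E : PseudoDoubleCat.{u', v', w', x'}} {V : D.Obj ⥤ E.Obj} (F : PseudoDoubleFunctor D E V)
    {a b a' b' : D.Obj} {p : D.Hor a b} {p' : D.Hor a' b'} (σ : D.Mor p p') :
    E.Mor (F.hor p) (F.hor p') :=
  ⟨V.map σ.1, V.map σ.2.1, F.sq σ.2.2⟩

/-! ## Comonoids and effects handlers

Comonoids and their homomorphisms are Mathlib's `Comon C`, with counit `ε` and comultiplication `Δ`.
The notions below make sense in any monoidal category, with `⊗` in place of `◁`. -/

section Handlers
variable {C : Type u} [Category.{v} C] [MonoidalCategory C]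

/-- A `(c, d)`-effects handler: an object `s` with a morphism `φ : s ◁ d → c ◁ s` that commutes with
the counits and the comultiplications of `c` and `d`. -/
structure EffHandler (c d : Comon C) where
  X : C
  act : X ⊗ d.X ⟶ c.X ⊗ X
  act_counit : act ≫ ε[c.X] ▷ X ≫ (λ_ X).hom = X ◁ ε[d.X] ≫ (ρ_ X).hom
  act_comul : act ≫ Δ[c.X] ▷ X ≫ (α_ c.X c.X X).hom =
    X ◁ Δ[d.X] ≫ (α_ X d.X d.X).inv ≫ act ▷ d.X ≫ (α_ c.X X d.X).hom ≫ c.X ◁ act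

namespace EffHandler

/-- A square from `(s, φ)` to `(s', φ')` with vertical sides `f`, `g`: a morphism `γ : s → s'` such
that `φ` followed by `f ◁ γ` is `γ ◁ g` followed by `φ'`. -/
@[ext]
structure Sq {c d c' d' : Comon C} (s : EffHandler c d) (s' : EffHandler c' d')
    (f : c ⟶ c') (g : d ⟶ d') where
  hom : s.X ⟶ s'.X
  comm : s.act ≫ (f.hom ⊗ₘ hom) = (hom ⊗ₘ g.hom) ≫ s'.act

theorem Sq.hext {c d c' d' : Comon C} {s : EffHandler c d} {s' : EffHandler c' d'}
    {f f' : c ⟶ c'} {g g' : d ⟶ d'} {σ : Sq s s' f g} {τ : Sq s s' f' g'}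
    (hf : f = f') (hg : g = g') (h : σ.hom = τ.hom) : HEq σ τ := by
  subst hf hg
  exact heq_of_eq (Sq.ext h)

/-- The identity effects handler on `c`, with carrier the unit object `y`. -/
abbrev unit (c : Comon C) : EffHandler c c where
  X := 𝟙_ C
  act := (λ_ c.X).hom ≫ (ρ_ c.X).inv
  act_counit := by monoidal
  act_comul := by
    monoidal

/-- The composite `s ◁ t`, with structure map
`s ◁ t ◁ e → s ◁ d ◁ t → c ◁ s ◁ t`. -/
abbrev comp {c d e : Comon C} (s : EffHandler c d) (t : EffHandler d e) : EffHandler c e where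
  X := s.X ⊗ t.X
  act := (α_ s.X t.X e.X).hom ≫ s.X ◁ t.act ≫ (α_ s.X d.X t.X).inv ≫ s.act ▷ t.X ≫
    (α_ c.X s.X t.X).hom
  act_counit := by
    have hs := s.act_counit
    have ht := t.act_counit
    calc _ = (α_ s.X t.X e.X).hom ≫ s.X ◁ t.act ≫ (α_ s.X d.X t.X).inv ≫
            (s.act ≫ ε[c.X] ▷ s.X ≫ (λ_ s.X).hom) ▷ t.X := by monoidal
      _ = (α_ s.X t.X e.X).hom ≫ s.X ◁ (t.act ≫ ε[d.X] ▷ t.X ≫ (λ_ t.X).hom) := by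
          rw [hs]; monoidal
      _ = _ := by rw [ht]; monoidal
  act_comul := by
    have hs := s.act_comul
    have ht := t.act_comul
    calc _ = (α_ s.X t.X e.X).hom ≫ s.X ◁ t.act ≫ (α_ s.X d.X t.X).inv ≫
            (s.act ≫ Δ[c.X] ▷ s.X ≫ (α_ _ _ _).hom) ▷ t.X ≫
              (α_ c.X (c.X ⊗ s.X) t.X).hom ≫ c.X ◁ (α_ c.X s.X t.X).hom := by monoidal
      _ = (α_ s.X t.X e.X).hom ≫ s.X ◁ (t.act ≫ Δ[d.X] ▷ t.X ≫ (α_ _ _ _).hom) ≫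
            (α_ _ _ _).inv ≫ (s.act ▷ (d.X ⊗ t.X)) ≫ (α_ _ _ _).hom ≫
            c.X ◁ (α_ _ _ _).inv ≫ c.X ◁ s.act ▷ t.X ≫ c.X ◁ (α_ _ _ _).hom := by
          rw [hs]; monoidal
      _ = (α_ s.X t.X e.X).hom ≫ s.X ◁ (t.X ◁ Δ[e.X] ≫ (α_ t.X e.X e.X).inv ≫ t.act ▷ e.X ≫
            (α_ d.X t.X e.X).hom) ≫ (α_ _ _ _).inv ≫ ((s.X ⊗ d.X) ◁ t.act ≫
            (s.act ▷ (d.X ⊗ t.X))) ≫ (α_ _ _ _).hom ≫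
            c.X ◁ (α_ _ _ _).inv ≫ c.X ◁ s.act ▷ t.X ≫ c.X ◁ (α_ _ _ _).hom := by
          rw [ht]; monoidal
      _ = _ := by rw [MonoidalCategory.whisker_exchange]; monoidal

/-- The identity square on a vertical morphism. -/
def unitSq {c c' : Comon C} (f : c ⟶ c') : Sq (unit c) (unit c') f f where
  hom := 𝟙 _
  comm := by simp [unit]

/-- Horizontal composition of squares. -/
def compSq {c d e c' d' e' : Comon C} {s : EffHandler c d} {t : EffHandler d e}
    {s' : EffHandler c' d'} {t' : EffHandler d' e'} {f : c ⟶ c'} {g : d ⟶ d'} {h : e ⟶ e'}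
    (σ : Sq s s' f g) (τ : Sq t t' g h) : Sq (s.comp t) (s'.comp t') f h where
  hom := σ.hom ⊗ₘ τ.hom
  comm := by
    have h1 := σ.comm
    have h2 := τ.comm
    calc _ = (α_ s.X t.X e.X).hom ≫ s.X ◁ t.act ≫ (α_ s.X d.X t.X).inv ≫
            (s.act ≫ (f.hom ⊗ₘ σ.hom)) ▷ t.X ≫ (c'.X ⊗ s'.X) ◁ τ.hom ≫
            (α_ c'.X s'.X t'.X).hom := by
          simp only [comp, MonoidalCategory.tensorHom_def]
          monoidal
      _ = (α_ s.X t.X e.X).hom ≫ s.X ◁ t.act ≫ (α_ s.X d.X t.X).inv ≫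
            (σ.hom ⊗ₘ g.hom) ▷ t.X ≫ (s'.act ▷ t.X ≫ (c'.X ⊗ s'.X) ◁ τ.hom) ≫
            (α_ c'.X s'.X t'.X).hom := by rw [h1]; monoidal
      _ = (α_ s.X t.X e.X).hom ≫ s.X ◁ t.act ≫ (α_ s.X d.X t.X).inv ≫
            ((σ.hom ⊗ₘ g.hom) ⊗ₘ τ.hom) ≫ s'.act ▷ t'.X ≫
            (α_ c'.X s'.X t'.X).hom := by
          rw [← MonoidalCategory.whisker_exchange]
          simp only [MonoidalCategory.tensorHom_def _ τ.hom, Category.assoc]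
      _ = (α_ s.X t.X e.X).hom ≫ (σ.hom ⊗ₘ (t.act ≫ (g.hom ⊗ₘ τ.hom))) ≫
            (α_ s'.X d'.X t'.X).inv ≫ s'.act ▷ t'.X ≫ (α_ c'.X s'.X t'.X).hom := by
          rw [← MonoidalCategory.associator_inv_naturality_assoc,
            ← MonoidalCategory.whiskerLeft_comp_tensorHom_assoc]
      _ = _ := by
          rw [h2]
          simp only [comp, Category.assoc, MonoidalCategory.associator_naturality_assoc,
            ← MonoidalCategory.tensorHom_comp_whiskerLeft]

/-- The identity square on an effects handler. -/
def Sq.id {c d : Comon C} (s : EffHandler c d) : Sq s s (𝟙 c) (𝟙 d) where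
  hom := 𝟙 s.X
  comm := by simp

/-- Vertical composition of squares. -/
def Sq.comp {c d c' d' c'' d'' : Comon C} {s : EffHandler c d} {s' : EffHandler c' d'}
    {s'' : EffHandler c'' d''} {f : c ⟶ c'} {g : d ⟶ d'} {f' : c' ⟶ c''} {g' : d' ⟶ d''}
    (σ : Sq s s' f g) (τ : Sq s' s'' f' g') : Sq s s'' (f ≫ f') (g ≫ g') where
  hom := σ.hom ≫ τ.hom
  comm := by
    have h1 := σ.comm
    have h2 := τ.comm
    rw [Comon.comp_hom', Comon.comp_hom', ← MonoidalCategory.tensorHom_comp_tensorHom,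
      reassoc_of% h1, h2, ← MonoidalCategory.tensorHom_comp_tensorHom, Category.assoc]

/-- A square with identity vertical sides. -/
def Sq.glob {c d : Comon C} {s t : EffHandler c d} (i : s.X ⟶ t.X)
    (hi : s.act ≫ c.X ◁ i = i ▷ d.X ≫ t.act) : Sq s t (𝟙 c) (𝟙 d) where
  hom := i
  comm := by simpa using hi

/-- The categories of comonoids and of effects handlers with their squares. -/
def base (C : Type u) [Category.{v} C] [MonoidalCategory C] : DoubleBase where
  Obj := Comon C
  Hor := EffHandler
  Sq := Sq
  vid := Sq.id
  vcomp := Sq.comp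
  vid_vcomp _ := Sq.hext (Category.id_comp _) (Category.id_comp _) (Category.id_comp _)
  vcomp_vid _ := Sq.hext (Category.comp_id _) (Category.comp_id _) (Category.comp_id _)
  vcomp_assoc _ _ _ :=
    Sq.hext (Category.assoc _ _ _) (Category.assoc _ _ _) (Category.assoc _ _ _)

/-- An invertible globular square from an isomorphism of carriers. -/
def globIso {c d : Comon C} {s t : EffHandler c d} (i : s.X ≅ t.X)
    (hi : s.act ≫ c.X ◁ i.hom = i.hom ▷ d.X ≫ t.act) :
    (base C).GlobIso (a := c) (b := d) s t where
  hom := Sq.glob i.hom hi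
  inv := Sq.glob i.inv (by
    have h : t.act = i.inv ▷ d.X ≫ s.act ≫ c.X ◁ i.hom := by simp [hi]
    simp [h])
  hom_inv := Sq.hext (Category.id_comp _) (Category.id_comp _) i.hom_inv_id
  inv_hom := Sq.hext (Category.id_comp _) (Category.id_comp _) i.inv_hom_id

/-- The pseudo-double category of comonoids, comonoid homomorphisms, effects handlers and squares. -/
def double (C : Type u) [Category.{v} C] [MonoidalCategory C] : PseudoDoubleCat where
  toDoubleBase := base C
  hid := unit
  hidSq := unitSq
  hidSq_id _ := rfl
  hidSq_comp _ _ := Sq.ext (Category.comp_id _).symm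
  hcomp := comp
  hcompSq := compSq
  hcompSq_vid _ _ := Sq.ext (MonoidalCategory.id_tensorHom_id _ _)
  hcompSq_vcomp _ _ _ _ := Sq.ext (MonoidalCategory.tensorHom_comp_tensorHom _ _ _ _).symm
  assoc p q r := globIso (α_ p.X q.X r.X) (by
    dsimp [comp]
    monoidal)
  leftUnitor p := globIso (λ_ p.X) (by
    dsimp [comp, unit]
    monoidal)
  rightUnitor p := globIso (ρ_ p.X) (by
    dsimp [comp, unit]
    monoidal)
  assoc_naturality _ _ _ := Sq.hext ((Category.comp_id _).trans (Category.id_comp _).symm)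
    ((Category.comp_id _).trans (Category.id_comp _).symm)
    (MonoidalCategory.associator_naturality _ _ _)
  leftUnitor_naturality σ := Sq.hext ((Category.comp_id _).trans (Category.id_comp _).symm)
    ((Category.comp_id _).trans (Category.id_comp _).symm)
    ((congrArg (· ≫ _) (MonoidalCategory.id_tensorHom _ _)).trans
      (MonoidalCategory.leftUnitor_naturality _))
  rightUnitor_naturality σ := Sq.hext ((Category.comp_id _).trans (Category.id_comp _).symm)
    ((Category.comp_id _).trans (Category.id_comp _).symm)
    ((congrArg (· ≫ _) (MonoidalCategory.tensorHom_id _ _)).trans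
      (MonoidalCategory.rightUnitor_naturality _))
  pentagon p q r s := Sq.hext
    (congrArg (· ≫ _) (Category.id_comp _)) (congrArg (· ≫ _) (Category.id_comp _))
    (show (((α_ p.X q.X r.X).hom ⊗ₘ 𝟙 s.X) ≫ (α_ p.X (q.X ⊗ r.X) s.X).hom) ≫
        (𝟙 p.X ⊗ₘ (α_ q.X r.X s.X).hom) =
      (α_ (p.X ⊗ q.X) r.X s.X).hom ≫ (α_ p.X q.X (r.X ⊗ s.X)).hom by simp)
  triangle p q := Sq.hext (Category.id_comp _) (Category.id_comp _)
    (show (α_ p.X (𝟙_ C) q.X).hom ≫ (𝟙 p.X ⊗ₘ (λ_ q.X).hom) = ((ρ_ p.X).hom ⊗ₘ 𝟙 q.X) by simp)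

end EffHandler
end Handlers

/-! ## Bicomodules -/

section Equalizers
variable {C : Type u} [Category.{v} C]

/-- `ι` is an equalizer of `f` and `g`. -/
def IsEqualizerOf {E A B : C} (ι : E ⟶ A) (f g : A ⟶ B) : Prop :=
  ∃ w : ι ≫ f = ι ≫ g, Nonempty (IsLimit (Fork.ofι ι w))

namespace IsEqualizerOf
variable {E A B : C} {ι : E ⟶ A} {f g : A ⟶ B}

theorem mono (h : IsEqualizerOf ι f g) : Mono ι := by
  obtain ⟨w, ⟨hl⟩⟩ := h
  exact mono_of_isLimit_fork hl

theorem exists_lift (h : IsEqualizerOf ι f g) {Z : C} (k : Z ⟶ A) (hk : k ≫ f = k ≫ g) :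
    ∃ l : Z ⟶ E, l ≫ ι = k := by
  obtain ⟨w, ⟨hl⟩⟩ := h
  exact ⟨Fork.IsLimit.lift hl k hk, Fork.IsLimit.lift_ι hl⟩

variable [MonoidalCategory C]

theorem whiskerLeft [TensorPreservesEqualizers C] (h : IsEqualizerOf ι f g) (X : C) :
    IsEqualizerOf (X ◁ ι) (X ◁ f) (X ◁ g) := by
  obtain ⟨w, ⟨hl⟩⟩ := h
  have := TensorPreservesEqualizers.left X f g
  exact ⟨_, ⟨isLimitForkMapOfIsLimit (tensorLeft X) w hl⟩⟩

theorem whiskerRight [TensorPreservesEqualizers C] (h : IsEqualizerOf ι f g) (X : C) :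
    IsEqualizerOf (ι ▷ X) (f ▷ X) (g ▷ X) := by
  obtain ⟨w, ⟨hl⟩⟩ := h
  have := TensorPreservesEqualizers.right X f g
  exact ⟨_, ⟨isLimitForkMapOfIsLimit (tensorRight X) w hl⟩⟩

end IsEqualizerOf
end Equalizers

section Bicomodules
variable {C : Type u} [Category.{v} C] [MonoidalCategory C]

/-- A `(c, d)`-bicomodule: an object `p` with coactions `c ◁ p ← p → p ◁ d` that are counital and
coassociative and commute with each other. -/
structure Bicomod (c d : Comon C) where
  X : C
  lact : X ⟶ c.X ⊗ X
  ract : X ⟶ X ⊗ d.X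
  lact_counit : lact ≫ ε[c.X] ▷ X = (λ_ X).inv
  lact_comul : lact ≫ Δ[c.X] ▷ X ≫ (α_ c.X c.X X).hom = lact ≫ c.X ◁ lact
  ract_counit : ract ≫ X ◁ ε[d.X] = (ρ_ X).inv
  ract_comul : ract ≫ X ◁ Δ[d.X] = ract ≫ ract ▷ d.X ≫ (α_ X d.X d.X).hom
  act_comm : lact ≫ c.X ◁ ract = ract ≫ lact ▷ d.X ≫ (α_ c.X X d.X).hom

namespace Bicomod

/-- A square from `p` to `p'` with vertical sides `f`, `g`: a morphism `p → p'` that commutes with the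
coactions along `f` and `g`. -/
@[ext]
structure Sq {c d c' d' : Comon C} (p : Bicomod c d) (p' : Bicomod c' d')
    (f : c ⟶ c') (g : d ⟶ d') where
  hom : p.X ⟶ p'.X
  lact_hom : p.lact ≫ (f.hom ⊗ₘ hom) = hom ≫ p'.lact
  ract_hom : p.ract ≫ (hom ⊗ₘ g.hom) = hom ≫ p'.ract

theorem Sq.hext {c d c' d' : Comon C} {p : Bicomod c d} {p' : Bicomod c' d'}
    {f f' : c ⟶ c'} {g g' : d ⟶ d'} {σ : Sq p p' f g} {τ : Sq p p' f' g'}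
    (hf : f = f') (hg : g = g') (h : σ.hom = τ.hom) : HEq σ τ := by
  subst hf hg
  exact heq_of_eq (Sq.ext h)

/-- The identity square on a bicomodule. -/
def Sq.id {c d : Comon C} (p : Bicomod c d) : Sq p p (𝟙 c) (𝟙 d) where
  hom := 𝟙 p.X
  lact_hom := by simp
  ract_hom := by simp

/-- Vertical composition of squares. -/
def Sq.comp {c d c' d' c'' d'' : Comon C} {p : Bicomod c d} {p' : Bicomod c' d'}
    {p'' : Bicomod c'' d''} {f : c ⟶ c'} {g : d ⟶ d'} {f' : c' ⟶ c''} {g' : d' ⟶ d''}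
    (σ : Sq p p' f g) (τ : Sq p' p'' f' g') : Sq p p'' (f ≫ f') (g ≫ g') where
  hom := σ.hom ≫ τ.hom
  lact_hom := by
    rw [Comon.comp_hom', ← MonoidalCategory.tensorHom_comp_tensorHom, reassoc_of% σ.lact_hom,
      τ.lact_hom, Category.assoc]
  ract_hom := by
    rw [Comon.comp_hom', ← MonoidalCategory.tensorHom_comp_tensorHom, reassoc_of% σ.ract_hom,
      τ.ract_hom, Category.assoc]

/-- A square with identity vertical sides. -/
def Sq.glob {c d : Comon C} {p q : Bicomod c d} (i : p.X ⟶ q.X)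
    (hl : p.lact ≫ c.X ◁ i = i ≫ q.lact) (hr : p.ract ≫ i ▷ d.X = i ≫ q.ract) :
    Sq p q (𝟙 c) (𝟙 d) where
  hom := i
  lact_hom := by simpa using hl
  ract_hom := by simpa using hr

/-- The categories of comonoids and of bicomodules with their squares. -/
def base (C : Type u) [Category.{v} C] [MonoidalCategory C] : DoubleBase where
  Obj := Comon C
  Hor := Bicomod
  Sq := Sq
  vid := Sq.id
  vcomp := Sq.comp
  vid_vcomp _ := Sq.hext (Category.id_comp _) (Category.id_comp _) (Category.id_comp _)
  vcomp_vid _ := Sq.hext (Category.comp_id _) (Category.comp_id _) (Category.comp_id _)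
  vcomp_assoc _ _ _ :=
    Sq.hext (Category.assoc _ _ _) (Category.assoc _ _ _) (Category.assoc _ _ _)

/-- An invertible globular square from an isomorphism of carriers. -/
def globIso {c d : Comon C} {p q : Bicomod c d} (i : p.X ≅ q.X)
    (hl : p.lact ≫ c.X ◁ i.hom = i.hom ≫ q.lact)
    (hr : p.ract ≫ i.hom ▷ d.X = i.hom ≫ q.ract) :
    (base C).GlobIso (a := c) (b := d) p q where
  hom := Sq.glob i.hom hl hr
  inv := Sq.glob i.inv
    (by rw [Iso.eq_inv_comp, ← reassoc_of% hl, ← MonoidalCategory.whiskerLeft_comp]; simp)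
    (by rw [Iso.eq_inv_comp, ← reassoc_of% hr, ← MonoidalCategory.comp_whiskerRight]; simp)
  hom_inv := Sq.hext (Category.id_comp _) (Category.id_comp _) i.hom_inv_id
  inv_hom := Sq.hext (Category.id_comp _) (Category.id_comp _) i.inv_hom_id

/-- The horizontal identity on `c`: the comultiplication bicomodule. -/
abbrev unit (c : Comon C) : Bicomod c c where
  X := c.X
  lact := Δ[c.X]
  ract := Δ[c.X]
  lact_counit := by simp
  lact_comul := by simp
  ract_counit := by simp
  ract_comul := by simp
  act_comm := by simp

/-- The identity square on a vertical morphism. -/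
def unitSq {c c' : Comon C} (f : c ⟶ c') : Sq (unit c) (unit c') f f where
  hom := f.hom
  lact_hom := by simp [unit]
  ract_hom := by simp [unit]

section Composition
variable {c d e : Comon C}

/-- The map `p ◁ q → p ◁ d ◁ q` given by the right coaction of `p`. -/
def parL (p : Bicomod c d) (q : Bicomod d e) : p.X ⊗ q.X ⟶ p.X ⊗ (d.X ⊗ q.X) :=
  p.ract ▷ q.X ≫ (α_ p.X d.X q.X).hom

/-- The map `p ◁ q → p ◁ d ◁ q` given by the left coaction of `q`. -/
def parR (p : Bicomod c d) (q : Bicomod d e) : p.X ⊗ q.X ⟶ p.X ⊗ (d.X ⊗ q.X) :=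
  p.X ◁ q.lact

variable [HasEqualizers C]

/-- The carrier `p ◁_d q` of the composite: the equalizer of the two maps `p ◁ q → p ◁ d ◁ q`. -/
noncomputable def compX (p : Bicomod c d) (q : Bicomod d e) : C :=
  equalizer (parL p q) (parR p q)

/-- The inclusion `p ◁_d q → p ◁ q`. -/
noncomputable def ι (p : Bicomod c d) (q : Bicomod d e) : compX p q ⟶ p.X ⊗ q.X :=
  equalizer.ι (parL p q) (parR p q)

theorem isEqualizerOf_ι (p : Bicomod c d) (q : Bicomod d e) :
    IsEqualizerOf (ι p q) (parL p q) (parR p q) :=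
  ⟨equalizer.condition _ _, ⟨equalizerIsEqualizer _ _⟩⟩

theorem ι_condition (p : Bicomod c d) (q : Bicomod d e) :
    ι p q ≫ p.ract ▷ q.X ≫ (α_ p.X d.X q.X).hom = ι p q ≫ p.X ◁ q.lact :=
  equalizer.condition (parL p q) (parR p q)

variable [TensorPreservesEqualizers C]

theorem exists_compLact (p : Bicomod c d) (q : Bicomod d e) :
    ∃ l : compX p q ⟶ c.X ⊗ compX p q,
      l ≫ c.X ◁ ι p q = ι p q ≫ p.lact ▷ q.X ≫ (α_ c.X p.X q.X).hom := by
  refine ((isEqualizerOf_ι p q).whiskerLeft c.X).exists_lift _ ?_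
  have hp := p.act_comm
  have hi := ι_condition p q
  calc _ = ι p q ≫ (p.lact ≫ c.X ◁ p.ract) ▷ q.X ≫ (α_ _ _ _).hom ≫ c.X ◁ (α_ _ _ _).hom := by
        simp only [parL]; monoidal
    _ = (ι p q ≫ p.ract ▷ q.X ≫ (α_ p.X d.X q.X).hom) ≫ p.lact ▷ (d.X ⊗ q.X) ≫ (α_ _ _ _).hom := by
        rw [hp]; monoidal
    _ = ι p q ≫ (p.X ◁ q.lact ≫ p.lact ▷ (d.X ⊗ q.X)) ≫ (α_ _ _ _).hom := by
        rw [hi]; simp only [Category.assoc]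
    _ = _ := by
        rw [MonoidalCategory.whisker_exchange]; simp only [parR]; monoidal

theorem exists_compRact (p : Bicomod c d) (q : Bicomod d e) :
    ∃ r : compX p q ⟶ compX p q ⊗ e.X,
      r ≫ ι p q ▷ e.X = ι p q ≫ p.X ◁ q.ract ≫ (α_ p.X q.X e.X).inv := by
  refine ((isEqualizerOf_ι p q).whiskerRight e.X).exists_lift _ ?_
  have hq := q.act_comm
  have hi := ι_condition p q
  calc _ = ι p q ≫ (p.X ◁ q.ract ≫ p.ract ▷ (q.X ⊗ e.X)) ≫ (α_ _ _ _).hom ≫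
          p.X ◁ (α_ _ _ _).inv ≫ (α_ _ _ _).inv := by
        simp only [parL]; monoidal
    _ = (ι p q ≫ p.ract ▷ q.X ≫ (α_ p.X d.X q.X).hom) ≫ p.X ◁ d.X ◁ q.ract ≫
          p.X ◁ (α_ _ _ _).inv ≫ (α_ _ _ _).inv := by
        rw [MonoidalCategory.whisker_exchange]; monoidal
    _ = ι p q ≫ p.X ◁ (q.lact ≫ d.X ◁ q.ract) ≫ p.X ◁ (α_ _ _ _).inv ≫ (α_ _ _ _).inv := by
        rw [hi]; monoidal
    _ = _ := by
        rw [hq]; simp only [parR]; monoidal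

/-- The left coaction of `p ◁_d q`, induced by that of `p`. -/
noncomputable def compLact (p : Bicomod c d) (q : Bicomod d e) :
    compX p q ⟶ c.X ⊗ compX p q :=
  (exists_compLact p q).choose

/-- The right coaction of `p ◁_d q`, induced by that of `q`. -/
noncomputable def compRact (p : Bicomod c d) (q : Bicomod d e) :
    compX p q ⟶ compX p q ⊗ e.X :=
  (exists_compRact p q).choose

theorem compLact_ι (p : Bicomod c d) (q : Bicomod d e) :
    compLact p q ≫ c.X ◁ ι p q = ι p q ≫ p.lact ▷ q.X ≫ (α_ c.X p.X q.X).hom :=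
  (exists_compLact p q).choose_spec

theorem compRact_ι (p : Bicomod c d) (q : Bicomod d e) :
    compRact p q ≫ ι p q ▷ e.X = ι p q ≫ p.X ◁ q.ract ≫ (α_ p.X q.X e.X).inv :=
  (exists_compRact p q).choose_spec

/-- The composite bicomodule `p ◁_d q`. -/
noncomputable abbrev comp (p : Bicomod c d) (q : Bicomod d e) : Bicomod c e where
  X := compX p q
  lact := compLact p q
  ract := compRact p q
  lact_counit := by
    have := (isEqualizerOf_ι p q).mono
    have h := p.lact_counit
    rw [← cancel_mono (λ_ _).hom, ← cancel_mono (ι p q)]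
    calc _ = (compLact p q ≫ c.X ◁ ι p q) ≫ ε[c.X] ▷ (p.X ⊗ q.X) ≫ (λ_ _).hom := by
          simp only [Category.assoc, MonoidalCategory.whisker_exchange_assoc]; monoidal
      _ = ι p q ≫ (p.lact ≫ ε[c.X] ▷ p.X) ▷ q.X ≫ (α_ _ _ _).hom ≫ (λ_ _).hom := by
          rw [compLact_ι]; monoidal
      _ = _ := by rw [h]; monoidal
  lact_comul := by
    have := (((isEqualizerOf_ι p q).whiskerLeft c.X).whiskerLeft c.X).mono
    have h := p.lact_comul
    rw [← cancel_mono (c.X ◁ c.X ◁ ι p q)]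
    calc _ = (compLact p q ≫ c.X ◁ ι p q) ≫ Δ[c.X] ▷ (p.X ⊗ q.X) ≫ (α_ _ _ _).hom := by
          simp only [Category.assoc, MonoidalCategory.whisker_exchange_assoc]; monoidal
      _ = ι p q ≫ (p.lact ≫ Δ[c.X] ▷ p.X ≫ (α_ _ _ _).hom) ▷ q.X ≫ (α_ _ _ _).hom ≫
            c.X ◁ (α_ _ _ _).hom := by
          rw [compLact_ι]; monoidal
      _ = (ι p q ≫ p.lact ▷ q.X ≫ (α_ _ _ _).hom) ≫ c.X ◁ (p.lact ▷ q.X ≫ (α_ _ _ _).hom) := by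
          rw [h]; monoidal
      _ = (compLact p q ≫ c.X ◁ ι p q) ≫ c.X ◁ (p.lact ▷ q.X ≫ (α_ _ _ _).hom) := by
          rw [compLact_ι]
      _ = compLact p q ≫ c.X ◁ (ι p q ≫ p.lact ▷ q.X ≫ (α_ _ _ _).hom) := by monoidal
      _ = _ := by rw [← compLact_ι]; monoidal
  ract_counit := by
    have := (isEqualizerOf_ι p q).mono
    have h := q.ract_counit
    rw [← cancel_mono (ρ_ _).hom, ← cancel_mono (ι p q)]
    calc _ = (compRact p q ≫ ι p q ▷ e.X) ≫ (p.X ⊗ q.X) ◁ ε[e.X] ≫ (ρ_ _).hom := by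
          simp only [Category.assoc, ← MonoidalCategory.whisker_exchange_assoc]; monoidal
      _ = ι p q ≫ p.X ◁ (q.ract ≫ q.X ◁ ε[e.X]) ≫ (α_ _ _ _).inv ≫ (ρ_ _).hom := by
          rw [compRact_ι]; monoidal
      _ = _ := by rw [h]; monoidal
  ract_comul := by
    have := ((isEqualizerOf_ι p q).whiskerRight (e.X ⊗ e.X)).mono
    have h := q.ract_comul
    rw [← cancel_mono (ι p q ▷ (e.X ⊗ e.X))]
    calc _ = (compRact p q ≫ ι p q ▷ e.X) ≫ (p.X ⊗ q.X) ◁ Δ[e.X] := by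
          rw [Category.assoc, Category.assoc, ← MonoidalCategory.whisker_exchange]
      _ = ι p q ≫ p.X ◁ (q.ract ≫ q.X ◁ Δ[e.X]) ≫ (α_ _ _ _).inv := by
          rw [compRact_ι]; monoidal
      _ = (ι p q ≫ p.X ◁ q.ract ≫ (α_ _ _ _).inv) ≫ (p.X ◁ q.ract ≫ (α_ _ _ _).inv) ▷ e.X ≫
            (α_ _ _ _).hom := by
          rw [h]; monoidal
      _ = (compRact p q ≫ ι p q ▷ e.X) ≫ (p.X ◁ q.ract ≫ (α_ _ _ _).inv) ▷ e.X ≫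
            (α_ _ _ _).hom := by
          rw [compRact_ι]
      _ = compRact p q ≫ (ι p q ≫ p.X ◁ q.ract ≫ (α_ _ _ _).inv) ▷ e.X ≫ (α_ _ _ _).hom := by
          monoidal
      _ = _ := by rw [← compRact_ι]; monoidal
  act_comm := by
    have := (((isEqualizerOf_ι p q).whiskerRight e.X).whiskerLeft c.X).mono
    rw [← cancel_mono (c.X ◁ (ι p q ▷ e.X))]
    calc _ = compLact p q ≫ c.X ◁ (compRact p q ≫ ι p q ▷ e.X) := by monoidal
      _ = (compLact p q ≫ c.X ◁ ι p q) ≫ c.X ◁ (p.X ◁ q.ract ≫ (α_ _ _ _).inv) := by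
          rw [compRact_ι]; monoidal
      _ = ι p q ≫ (p.lact ▷ q.X ≫ (c.X ⊗ p.X) ◁ q.ract) ≫ (α_ _ _ _).hom ≫
            c.X ◁ (α_ _ _ _).inv := by
          rw [compLact_ι]; monoidal
      _ = (ι p q ≫ p.X ◁ q.ract ≫ (α_ _ _ _).inv) ≫ (p.lact ▷ q.X ≫ (α_ _ _ _).hom) ▷ e.X ≫
            (α_ _ _ _).hom := by
          rw [← MonoidalCategory.whisker_exchange]; monoidal
      _ = compRact p q ≫ (ι p q ≫ p.lact ▷ q.X ≫ (α_ _ _ _).hom) ▷ e.X ≫ (α_ _ _ _).hom := by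
          rw [← compRact_ι]; monoidal
      _ = _ := by rw [← compLact_ι]; monoidal

theorem exists_compSq {c' d' e' : Comon C} {p : Bicomod c d} {q : Bicomod d e}
    {p' : Bicomod c' d'} {q' : Bicomod d' e'} {f : c ⟶ c'} {g : d ⟶ d'} {h : e ⟶ e'}
    (σ : Sq p p' f g) (τ : Sq q q' g h) :
    ∃ l : compX p q ⟶ compX p' q', l ≫ ι p' q' = ι p q ≫ (σ.hom ⊗ₘ τ.hom) := by
  refine (isEqualizerOf_ι p' q').exists_lift _ ?_
  have hi := ι_condition p q
  calc _ = ι p q ≫ ((σ.hom ≫ p'.ract) ⊗ₘ τ.hom) ≫ (α_ _ _ _).hom := by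
        simp only [parL, Category.assoc, ← MonoidalCategory.tensorHom_comp_whiskerRight]
    _ = (ι p q ≫ p.ract ▷ q.X ≫ (α_ _ _ _).hom) ≫ (σ.hom ⊗ₘ (g.hom ⊗ₘ τ.hom)) := by
        rw [← σ.ract_hom, ← MonoidalCategory.whiskerRight_comp_tensorHom]
        simp only [Category.assoc, MonoidalCategory.associator_naturality]
    _ = ι p q ≫ (σ.hom ⊗ₘ (q.lact ≫ (g.hom ⊗ₘ τ.hom))) := by
        rw [hi, ← MonoidalCategory.whiskerLeft_comp_tensorHom, Category.assoc]
    _ = _ := by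
        rw [τ.lact_hom, ← MonoidalCategory.tensorHom_comp_whiskerLeft, Category.assoc, parR]

/-- The morphism of equalizers induced by horizontally adjacent squares. -/
noncomputable def compSqHom {c' d' e' : Comon C} {p : Bicomod c d} {q : Bicomod d e}
    {p' : Bicomod c' d'} {q' : Bicomod d' e'} {f : c ⟶ c'} {g : d ⟶ d'} {h : e ⟶ e'}
    (σ : Sq p p' f g) (τ : Sq q q' g h) : compX p q ⟶ compX p' q' :=
  (exists_compSq σ τ).choose

theorem compSqHom_ι {c' d' e' : Comon C} {p : Bicomod c d} {q : Bicomod d e}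
    {p' : Bicomod c' d'} {q' : Bicomod d' e'} {f : c ⟶ c'} {g : d ⟶ d'} {h : e ⟶ e'}
    (σ : Sq p p' f g) (τ : Sq q q' g h) :
    compSqHom σ τ ≫ ι p' q' = ι p q ≫ (σ.hom ⊗ₘ τ.hom) :=
  (exists_compSq σ τ).choose_spec

/-- Horizontal composition of squares. -/
noncomputable def compSq {c' d' e' : Comon C} {p : Bicomod c d} {q : Bicomod d e}
    {p' : Bicomod c' d'} {q' : Bicomod d' e'} {f : c ⟶ c'} {g : d ⟶ d'} {h : e ⟶ e'}
    (σ : Sq p p' f g) (τ : Sq q q' g h) : Sq (p.comp q) (p'.comp q') f h where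
  hom := compSqHom σ τ
  lact_hom := by
    have := ((isEqualizerOf_ι p' q').whiskerLeft c'.X).mono
    change compLact p q ≫ (f.hom ⊗ₘ compSqHom σ τ) = compSqHom σ τ ≫ compLact p' q'
    rw [← cancel_mono (c'.X ◁ ι p' q')]
    calc _ = (compLact p q ≫ c.X ◁ ι p q) ≫ (f.hom ⊗ₘ (σ.hom ⊗ₘ τ.hom)) := by
          rw [Category.assoc, Category.assoc, MonoidalCategory.tensorHom_comp_whiskerLeft,
            compSqHom_ι, MonoidalCategory.whiskerLeft_comp_tensorHom]
      _ = ι p q ≫ ((p.lact ≫ (f.hom ⊗ₘ σ.hom)) ⊗ₘ τ.hom) ≫ (α_ _ _ _).hom := by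
          rw [compLact_ι, ← MonoidalCategory.whiskerRight_comp_tensorHom]
          simp only [Category.assoc, MonoidalCategory.associator_naturality]
      _ = (ι p q ≫ (σ.hom ⊗ₘ τ.hom)) ≫ p'.lact ▷ q'.X ≫ (α_ _ _ _).hom := by
          rw [σ.lact_hom, ← MonoidalCategory.tensorHom_comp_whiskerRight]
          simp only [Category.assoc]
      _ = _ := by
          rw [← compSqHom_ι, Category.assoc, Category.assoc, compLact_ι]
  ract_hom := by
    have := ((isEqualizerOf_ι p' q').whiskerRight e'.X).mono
    change compRact p q ≫ (compSqHom σ τ ⊗ₘ h.hom) = compSqHom σ τ ≫ compRact p' q'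
    rw [← cancel_mono (ι p' q' ▷ e'.X)]
    calc _ = (compRact p q ≫ ι p q ▷ e.X) ≫ ((σ.hom ⊗ₘ τ.hom) ⊗ₘ h.hom) := by
          rw [Category.assoc, Category.assoc, MonoidalCategory.tensorHom_comp_whiskerRight,
            compSqHom_ι, MonoidalCategory.whiskerRight_comp_tensorHom]
      _ = ι p q ≫ (σ.hom ⊗ₘ (q.ract ≫ (τ.hom ⊗ₘ h.hom))) ≫ (α_ _ _ _).inv := by
          rw [compRact_ι, ← MonoidalCategory.whiskerLeft_comp_tensorHom]
          simp only [Category.assoc, MonoidalCategory.associator_inv_naturality]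
      _ = (ι p q ≫ (σ.hom ⊗ₘ τ.hom)) ≫ p'.X ◁ q'.ract ≫ (α_ _ _ _).inv := by
          rw [τ.ract_hom, ← MonoidalCategory.tensorHom_comp_whiskerLeft]
          simp only [Category.assoc]
      _ = _ := by
          rw [← compSqHom_ι, Category.assoc, Category.assoc, compRact_ι]

/-! associator -/

variable {e' : Comon C}

/-- The inclusion `(p ◁_d q) ◁_e r → p ◁ (q ◁ r)`. -/
noncomputable def ιL (p : Bicomod c d) (q : Bicomod d e) (r : Bicomod e e') :
    compX (p.comp q) r ⟶ p.X ⊗ (q.X ⊗ r.X) :=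
  ι (p.comp q) r ≫ ι p q ▷ r.X ≫ (α_ p.X q.X r.X).hom

/-- The inclusion `p ◁_d (q ◁_e r) → p ◁ (q ◁ r)`. -/
noncomputable def ιR (p : Bicomod c d) (q : Bicomod d e) (r : Bicomod e e') :
    compX p (q.comp r) ⟶ p.X ⊗ (q.X ⊗ r.X) :=
  ι p (q.comp r) ≫ p.X ◁ ι q r

theorem mono_ιL (p : Bicomod c d) (q : Bicomod d e) (r : Bicomod e e') : Mono (ιL p q r) := by
  have := (isEqualizerOf_ι (p.comp q) r).mono
  have := ((isEqualizerOf_ι p q).whiskerRight r.X).mono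
  unfold ιL
  exact mono_comp' ‹_› (mono_comp' ‹_› inferInstance)

theorem mono_ιR (p : Bicomod c d) (q : Bicomod d e) (r : Bicomod e e') : Mono (ιR p q r) := by
  have := (isEqualizerOf_ι p (q.comp r)).mono
  have := ((isEqualizerOf_ι q r).whiskerLeft p.X).mono
  unfold ιR
  exact mono_comp' ‹_› ‹_›

/-- `k` equalizes the two pairs of maps out of `p ◁ (q ◁ r)` given by the coactions. -/
structure Balanced (p : Bicomod c d) (q : Bicomod d e) (r : Bicomod e e') {Z : C}
    (k : Z ⟶ p.X ⊗ (q.X ⊗ r.X)) : Prop where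
  left : k ≫ p.ract ▷ (q.X ⊗ r.X) ≫ (α_ p.X d.X (q.X ⊗ r.X)).hom =
    k ≫ p.X ◁ (q.lact ▷ r.X ≫ (α_ d.X q.X r.X).hom)
  right : k ≫ p.X ◁ (q.ract ▷ r.X ≫ (α_ q.X e.X r.X).hom) = k ≫ p.X ◁ (q.X ◁ r.lact)

theorem balanced_ιL (p : Bicomod c d) (q : Bicomod d e) (r : Bicomod e e') :
    Balanced p q r (ιL p q r) where
  left := by
    have h := ι_condition p q
    calc _ = ι (p.comp q) r ≫ (ι p q ≫ p.ract ▷ q.X ≫ (α_ _ _ _).hom) ▷ r.X ≫ (α_ _ _ _).hom ≫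
            p.X ◁ (α_ _ _ _).hom := by simp only [ιL]; monoidal
      _ = _ := by rw [h]; simp only [ιL]; monoidal
  right := by
    have h : ι (p.comp q) r ≫ compRact p q ▷ r.X ≫ (α_ _ _ _).hom =
      ι (p.comp q) r ≫ compX p q ◁ r.lact := ι_condition (p.comp q) r
    calc _ = ι (p.comp q) r ≫ (ι p q ≫ p.X ◁ q.ract ≫ (α_ _ _ _).inv) ▷ r.X ≫ (α_ _ _ _).hom ≫
            (α_ _ _ _).hom := by simp only [ιL]; monoidal
      _ = (ι (p.comp q) r ≫ compRact p q ▷ r.X ≫ (α_ _ _ _).hom) ≫ ι p q ▷ (e.X ⊗ r.X) ≫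
            (α_ _ _ _).hom := by rw [← compRact_ι]; monoidal
      _ = ι (p.comp q) r ≫ ι p q ▷ r.X ≫ (p.X ⊗ q.X) ◁ r.lact ≫ (α_ _ _ _).hom := by
          rw [h, Category.assoc, MonoidalCategory.whisker_exchange_assoc]
      _ = _ := by simp only [ιL]; monoidal

theorem balanced_ιR (p : Bicomod c d) (q : Bicomod d e) (r : Bicomod e e') :
    Balanced p q r (ιR p q r) where
  left := by
    have h : ι p (q.comp r) ≫ p.ract ▷ compX q r ≫ (α_ _ _ _).hom =
      ι p (q.comp r) ≫ p.X ◁ compLact q r := ι_condition p (q.comp r)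
    calc _ = (ι p (q.comp r) ≫ p.ract ▷ compX q r ≫ (α_ _ _ _).hom) ≫
            p.X ◁ (d.X ◁ ι q r) := by
          simp only [ιR, Category.assoc, MonoidalCategory.whisker_exchange_assoc]; monoidal
      _ = ι p (q.comp r) ≫ p.X ◁ (compLact q r ≫ d.X ◁ ι q r) := by rw [h]; monoidal
      _ = _ := by rw [compLact_ι]; simp only [ιR]; monoidal
  right := by
    have h := ι_condition q r
    calc _ = ι p (q.comp r) ≫ p.X ◁ (ι q r ≫ q.ract ▷ r.X ≫ (α_ _ _ _).hom) := by
          simp only [ιR]; monoidal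
      _ = _ := by rw [h]; simp only [ιR]; monoidal

theorem Balanced.exists_liftL {p : Bicomod c d} {q : Bicomod d e} {r : Bicomod e e'} {Z : C}
    {k : Z ⟶ p.X ⊗ (q.X ⊗ r.X)} (hk : Balanced p q r k) :
    ∃ l : Z ⟶ compX (p.comp q) r, l ≫ ιL p q r = k := by
  obtain ⟨k₁, hk₁⟩ := ((isEqualizerOf_ι p q).whiskerRight r.X).exists_lift
    (k ≫ (α_ _ _ _).inv) (by
      calc _ = (k ≫ p.ract ▷ (q.X ⊗ r.X) ≫ (α_ p.X d.X (q.X ⊗ r.X)).hom) ≫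
              p.X ◁ (α_ _ _ _).inv ≫ (α_ _ _ _).inv := by simp only [parL]; monoidal
        _ = _ := by rw [hk.left]; simp only [parR]; monoidal)
  have hm := ((isEqualizerOf_ι p q).whiskerRight (e.X ⊗ r.X)).mono
  obtain ⟨l, hl⟩ := (isEqualizerOf_ι (p.comp q) r).exists_lift k₁ (by
    change k₁ ≫ compRact p q ▷ r.X ≫ (α_ _ _ _).hom = k₁ ≫ compX p q ◁ r.lact
    rw [← cancel_mono (ι p q ▷ (e.X ⊗ r.X))]
    calc _ = k₁ ≫ (compRact p q ≫ ι p q ▷ e.X) ▷ r.X ≫ (α_ _ _ _).hom := by monoidal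
      _ = (k₁ ≫ ι p q ▷ r.X) ≫ (p.X ◁ q.ract ≫ (α_ _ _ _).inv) ▷ r.X ≫ (α_ _ _ _).hom := by
          rw [compRact_ι]; monoidal
      _ = (k ≫ p.X ◁ (q.ract ▷ r.X ≫ (α_ q.X e.X r.X).hom)) ≫ (α_ _ _ _).inv := by
          rw [hk₁]; monoidal
      _ = (k ≫ (α_ _ _ _).inv) ≫ (p.X ⊗ q.X) ◁ r.lact := by
          rw [hk.right]; monoidal
      _ = _ := by
          rw [← hk₁, Category.assoc, Category.assoc, MonoidalCategory.whisker_exchange])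
  refine ⟨l, ?_⟩
  rw [ιL, reassoc_of% hl, reassoc_of% hk₁, Iso.inv_hom_id, Category.comp_id]

theorem Balanced.exists_liftR {p : Bicomod c d} {q : Bicomod d e} {r : Bicomod e e'} {Z : C}
    {k : Z ⟶ p.X ⊗ (q.X ⊗ r.X)} (hk : Balanced p q r k) :
    ∃ l : Z ⟶ compX p (q.comp r), l ≫ ιR p q r = k := by
  obtain ⟨k₁, hk₁⟩ := ((isEqualizerOf_ι q r).whiskerLeft p.X).exists_lift k hk.right
  have hm := (((isEqualizerOf_ι q r).whiskerLeft d.X).whiskerLeft p.X).mono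
  obtain ⟨l, hl⟩ := (isEqualizerOf_ι p (q.comp r)).exists_lift k₁ (by
    change k₁ ≫ p.ract ▷ compX q r ≫ (α_ _ _ _).hom = k₁ ≫ p.X ◁ compLact q r
    rw [← cancel_mono (p.X ◁ d.X ◁ ι q r)]
    calc _ = (k₁ ≫ p.X ◁ ι q r) ≫ p.ract ▷ (q.X ⊗ r.X) ≫ (α_ _ _ _).hom := by
          simp only [Category.assoc, MonoidalCategory.whisker_exchange_assoc]; monoidal
      _ = (k₁ ≫ p.X ◁ ι q r) ≫ p.X ◁ (q.lact ▷ r.X ≫ (α_ d.X q.X r.X).hom) := by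
          rw [hk₁, hk.left]
      _ = k₁ ≫ p.X ◁ (compLact q r ≫ d.X ◁ ι q r) := by rw [compLact_ι]; monoidal
      _ = _ := by monoidal)
  refine ⟨l, ?_⟩
  rw [ιR, reassoc_of% hl, hk₁]

theorem lact_ιL (p : Bicomod c d) (q : Bicomod d e) (r : Bicomod e e') :
    compLact (p.comp q) r ≫ c.X ◁ ιL p q r =
      ιL p q r ≫ p.lact ▷ (q.X ⊗ r.X) ≫ (α_ _ _ _).hom := by
  have h1 : compLact (p.comp q) r ≫ c.X ◁ ι (p.comp q) r =
    ι (p.comp q) r ≫ compLact p q ▷ r.X ≫ (α_ _ _ _).hom := compLact_ι (p.comp q) r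
  calc _ = (compLact (p.comp q) r ≫ c.X ◁ ι (p.comp q) r) ≫ c.X ◁ (ι p q ▷ r.X) ≫
          c.X ◁ (α_ _ _ _).hom := by simp only [ιL]; monoidal
    _ = ι (p.comp q) r ≫ (compLact p q ≫ c.X ◁ ι p q) ▷ r.X ≫ (α_ _ _ _).hom ≫
          c.X ◁ (α_ _ _ _).hom := by rw [h1]; monoidal
    _ = _ := by rw [compLact_ι]; simp only [ιL]; monoidal

theorem lact_ιR (p : Bicomod c d) (q : Bicomod d e) (r : Bicomod e e') :
    compLact p (q.comp r) ≫ c.X ◁ ιR p q r =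
      ιR p q r ≫ p.lact ▷ (q.X ⊗ r.X) ≫ (α_ _ _ _).hom := by
  have h1 : compLact p (q.comp r) ≫ c.X ◁ ι p (q.comp r) =
    ι p (q.comp r) ≫ p.lact ▷ compX q r ≫ (α_ _ _ _).hom := compLact_ι p (q.comp r)
  calc _ = (compLact p (q.comp r) ≫ c.X ◁ ι p (q.comp r)) ≫ c.X ◁ (p.X ◁ ι q r) := by
        simp only [ιR]; monoidal
    _ = ι p (q.comp r) ≫ (p.lact ▷ compX q r ≫ (c.X ⊗ p.X) ◁ ι q r) ≫ (α_ _ _ _).hom := by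
        rw [h1]; monoidal
    _ = _ := by rw [← MonoidalCategory.whisker_exchange]; simp only [ιR]; monoidal

theorem ract_ιL (p : Bicomod c d) (q : Bicomod d e) (r : Bicomod e e') :
    compRact (p.comp q) r ≫ ιL p q r ▷ e'.X =
      ιL p q r ≫ p.X ◁ (q.X ◁ r.ract ≫ (α_ _ _ _).inv) ≫ (α_ _ _ _).inv := by
  have h1 : compRact (p.comp q) r ≫ ι (p.comp q) r ▷ e'.X =
    ι (p.comp q) r ≫ compX p q ◁ r.ract ≫ (α_ _ _ _).inv := compRact_ι (p.comp q) r
  calc _ = (compRact (p.comp q) r ≫ ι (p.comp q) r ▷ e'.X) ≫ (ι p q ▷ r.X) ▷ e'.X ≫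
          (α_ _ _ _).hom ▷ e'.X := by simp only [ιL]; monoidal
    _ = ι (p.comp q) r ≫ (compX p q ◁ r.ract ≫ ι p q ▷ (r.X ⊗ e'.X)) ≫ (α_ _ _ _).inv ≫
          (α_ _ _ _).hom ▷ e'.X := by rw [h1]; monoidal
    _ = _ := by rw [MonoidalCategory.whisker_exchange]; simp only [ιL]; monoidal

theorem ract_ιR (p : Bicomod c d) (q : Bicomod d e) (r : Bicomod e e') :
    compRact p (q.comp r) ≫ ιR p q r ▷ e'.X =
      ιR p q r ≫ p.X ◁ (q.X ◁ r.ract ≫ (α_ _ _ _).inv) ≫ (α_ _ _ _).inv := by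
  have h1 : compRact p (q.comp r) ≫ ι p (q.comp r) ▷ e'.X =
    ι p (q.comp r) ≫ p.X ◁ compRact q r ≫ (α_ _ _ _).inv := compRact_ι p (q.comp r)
  calc _ = (compRact p (q.comp r) ≫ ι p (q.comp r) ▷ e'.X) ≫ (p.X ◁ ι q r) ▷ e'.X := by
        simp only [ιR]; monoidal
    _ = ι p (q.comp r) ≫ p.X ◁ (compRact q r ≫ ι q r ▷ e'.X) ≫ (α_ _ _ _).inv := by
        rw [h1]; monoidal
    _ = _ := by rw [compRact_ι]; simp only [ιR]; monoidal

/-- The isomorphism `(p ◁_d q) ◁_e r ≅ p ◁_d (q ◁_e r)` over `p ◁ (q ◁ r)`. -/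
noncomputable def assocIso (p : Bicomod c d) (q : Bicomod d e) (r : Bicomod e e') :
    compX (p.comp q) r ≅ compX p (q.comp r) where
  hom := (balanced_ιL p q r).exists_liftR.choose
  inv := (balanced_ιR p q r).exists_liftL.choose
  hom_inv_id := by
    have := mono_ιL p q r
    rw [← cancel_mono (ιL p q r), Category.assoc, (balanced_ιR p q r).exists_liftL.choose_spec,
      (balanced_ιL p q r).exists_liftR.choose_spec, Category.id_comp]
  inv_hom_id := by
    have := mono_ιR p q r
    rw [← cancel_mono (ιR p q r), Category.assoc, (balanced_ιL p q r).exists_liftR.choose_spec,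
      (balanced_ιR p q r).exists_liftL.choose_spec, Category.id_comp]

theorem assocIso_hom_ιR (p : Bicomod c d) (q : Bicomod d e) (r : Bicomod e e') :
    (assocIso p q r).hom ≫ ιR p q r = ιL p q r :=
  (balanced_ιL p q r).exists_liftR.choose_spec

/-- The associator. -/
noncomputable def assoc (p : Bicomod c d) (q : Bicomod d e) (r : Bicomod e e') :
    (base C).GlobIso (a := c) (b := e') ((p.comp q).comp r) (p.comp (q.comp r)) :=
  globIso (assocIso p q r)
    (by
      change compLact (p.comp q) r ≫ c.X ◁ (assocIso p q r).hom =
        (assocIso p q r).hom ≫ compLact p (q.comp r)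
      have hm : Mono (c.X ◁ ιR p q r) := by
        have := ((isEqualizerOf_ι p (q.comp r)).whiskerLeft c.X).mono
        have := (((isEqualizerOf_ι q r).whiskerLeft p.X).whiskerLeft c.X).mono
        rw [ιR, MonoidalCategory.whiskerLeft_comp]
        exact mono_comp' ‹_› ‹_›
      rw [← cancel_mono (c.X ◁ ιR p q r), Category.assoc, Category.assoc,
        ← MonoidalCategory.whiskerLeft_comp, assocIso_hom_ιR, lact_ιL, lact_ιR,
        reassoc_of% (assocIso_hom_ιR p q r)])
    (by
      change compRact (p.comp q) r ≫ (assocIso p q r).hom ▷ e'.X =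
        (assocIso p q r).hom ≫ compRact p (q.comp r)
      have hm : Mono (ιR p q r ▷ e'.X) := by
        have := ((isEqualizerOf_ι p (q.comp r)).whiskerRight e'.X).mono
        have := (((isEqualizerOf_ι q r).whiskerLeft p.X).whiskerRight e'.X).mono
        rw [ιR, MonoidalCategory.comp_whiskerRight]
        exact mono_comp' ‹_› ‹_›
      rw [← cancel_mono (ιR p q r ▷ e'.X), Category.assoc, Category.assoc,
        ← MonoidalCategory.comp_whiskerRight, assocIso_hom_ιR, ract_ιL, ract_ιR,
        reassoc_of% (assocIso_hom_ιR p q r)])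

/-! unitors -/

theorem exists_leftUnitorInv (p : Bicomod c d) :
    ∃ l : p.X ⟶ compX (unit c) p, l ≫ ι (unit c) p = p.lact :=
  (isEqualizerOf_ι (unit c) p).exists_lift p.lact p.lact_comul

theorem exists_rightUnitorInv (p : Bicomod c d) :
    ∃ l : p.X ⟶ compX p (unit d), l ≫ ι p (unit d) = p.ract :=
  (isEqualizerOf_ι p (unit d)).exists_lift p.ract p.ract_comul.symm

/-- The isomorphism `c ◁_c p ≅ p`. -/
noncomputable def leftUnitorIso (p : Bicomod c d) : compX (unit c) p ≅ p.X where
  hom := ι (unit c) p ≫ ε[c.X] ▷ p.X ≫ (λ_ p.X).hom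
  inv := (exists_leftUnitorInv p).choose
  hom_inv_id := by
    have := (isEqualizerOf_ι (unit c) p).mono
    have hi : ι (unit c) p ≫ Δ[c.X] ▷ p.X ≫ (α_ _ _ _).hom = ι (unit c) p ≫ c.X ◁ p.lact :=
      ι_condition (unit c) p
    rw [← cancel_mono (ι (unit c) p), Category.assoc, (exists_leftUnitorInv p).choose_spec]
    change (ι (unit c) p ≫ ε[c.X] ▷ p.X ≫ (λ_ p.X).hom) ≫ p.lact = 𝟙 _ ≫ ι (unit c) p
    calc _ = (ι (unit c) p ≫ c.X ◁ p.lact) ≫ ε[c.X] ▷ (c.X ⊗ p.X) ≫ (λ_ _).hom := by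
          simp only [Category.assoc, MonoidalCategory.whisker_exchange_assoc]; monoidal
      _ = ι (unit c) p ≫ (Δ[c.X] ≫ ε[c.X] ▷ c.X) ▷ p.X ≫ (α_ _ _ _).hom ≫ (λ_ _).hom := by
          rw [← hi]; monoidal
      _ = _ := by
          rw [ComonObj.counit_comul]; monoidal
  inv_hom_id := by
    rw [reassoc_of% (exists_leftUnitorInv p).choose_spec, reassoc_of% p.lact_counit,
      Iso.inv_hom_id]

theorem leftUnitorIso_inv_ι (p : Bicomod c d) :
    (leftUnitorIso p).inv ≫ ι (unit c) p = p.lact :=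
  (exists_leftUnitorInv p).choose_spec

/-- The isomorphism `p ◁_d d ≅ p`. -/
noncomputable def rightUnitorIso (p : Bicomod c d) : compX p (unit d) ≅ p.X where
  hom := ι p (unit d) ≫ p.X ◁ ε[d.X] ≫ (ρ_ p.X).hom
  inv := (exists_rightUnitorInv p).choose
  hom_inv_id := by
    have := (isEqualizerOf_ι p (unit d)).mono
    have hi : ι p (unit d) ≫ p.ract ▷ d.X ≫ (α_ _ _ _).hom = ι p (unit d) ≫ p.X ◁ Δ[d.X] :=
      ι_condition p (unit d)
    rw [← cancel_mono (ι p (unit d)), Category.assoc, (exists_rightUnitorInv p).choose_spec]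
    change (ι p (unit d) ≫ p.X ◁ ε[d.X] ≫ (ρ_ p.X).hom) ≫ p.ract = 𝟙 _ ≫ ι p (unit d)
    calc _ = ι p (unit d) ≫ (p.X ◁ ε[d.X] ≫ p.ract ▷ 𝟙_ C) ≫ (ρ_ _).hom := by monoidal
      _ = (ι p (unit d) ≫ p.ract ▷ d.X ≫ (α_ _ _ _).hom) ≫ p.X ◁ (d.X ◁ ε[d.X]) ≫
            p.X ◁ (ρ_ _).hom := by
          rw [MonoidalCategory.whisker_exchange]; monoidal
      _ = ι p (unit d) ≫ p.X ◁ (Δ[d.X] ≫ d.X ◁ ε[d.X]) ≫ p.X ◁ (ρ_ _).hom := by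
          rw [hi]; monoidal
      _ = _ := by
          rw [ComonObj.comul_counit]; monoidal
  inv_hom_id := by
    rw [reassoc_of% (exists_rightUnitorInv p).choose_spec, reassoc_of% p.ract_counit,
      Iso.inv_hom_id]

theorem rightUnitorIso_inv_ι (p : Bicomod c d) :
    (rightUnitorIso p).inv ≫ ι p (unit d) = p.ract :=
  (exists_rightUnitorInv p).choose_spec

theorem leftUnitorIso_hom (p : Bicomod c d) :
    (leftUnitorIso p).hom = ι (unit c) p ≫ ε[c.X] ▷ p.X ≫ (λ_ p.X).hom :=
  rfl

theorem rightUnitorIso_hom (p : Bicomod c d) :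
    (rightUnitorIso p).hom = ι p (unit d) ≫ p.X ◁ ε[d.X] ≫ (ρ_ p.X).hom :=
  rfl

/-- The left unitor. -/
noncomputable def leftUnitor (p : Bicomod c d) :
    (base C).GlobIso (a := c) (b := d) ((unit c).comp p) p :=
  globIso (leftUnitorIso p)
    (by
      rw [← cancel_epi (leftUnitorIso p).inv, Iso.inv_hom_id_assoc]
      have h1 : compLact (unit c) p ≫ c.X ◁ ι (unit c) p =
        ι (unit c) p ≫ Δ[c.X] ▷ p.X ≫ (α_ _ _ _).hom := compLact_ι (unit c) p
      calc _ = (leftUnitorIso p).inv ≫ (compLact (unit c) p ≫ c.X ◁ ι (unit c) p) ≫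
              c.X ◁ (ε[c.X] ▷ p.X ≫ (λ_ p.X).hom) := by
            rw [leftUnitorIso_hom]; monoidal
        _ = ((leftUnitorIso p).inv ≫ ι (unit c) p) ≫ (Δ[c.X] ≫ c.X ◁ ε[c.X]) ▷ p.X ≫
              (α_ _ _ _).hom ≫ c.X ◁ (λ_ p.X).hom := by rw [h1]; monoidal
        _ = _ := by rw [leftUnitorIso_inv_ι, ComonObj.comul_counit]; monoidal)
    (by
      rw [← cancel_epi (leftUnitorIso p).inv, Iso.inv_hom_id_assoc]
      have h1 : compRact (unit c) p ≫ ι (unit c) p ▷ d.X =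
        ι (unit c) p ≫ c.X ◁ p.ract ≫ (α_ _ _ _).inv := compRact_ι (unit c) p
      calc _ = (leftUnitorIso p).inv ≫ (compRact (unit c) p ≫ ι (unit c) p ▷ d.X) ≫
              (ε[c.X] ▷ p.X ≫ (λ_ p.X).hom) ▷ d.X := by
            rw [leftUnitorIso_hom]; monoidal
        _ = ((leftUnitorIso p).inv ≫ ι (unit c) p) ≫ c.X ◁ p.ract ≫ (α_ _ _ _).inv ≫
              (ε[c.X] ▷ p.X ≫ (λ_ p.X).hom) ▷ d.X := by rw [h1]; monoidal
        _ = p.ract ≫ (p.lact ≫ ε[c.X] ▷ p.X ≫ (λ_ p.X).hom) ▷ d.X := by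
            rw [leftUnitorIso_inv_ι, reassoc_of% p.act_comm]; monoidal
        _ = _ := by rw [reassoc_of% p.lact_counit]; monoidal)

/-- The right unitor. -/
noncomputable def rightUnitor (p : Bicomod c d) :
    (base C).GlobIso (a := c) (b := d) (p.comp (unit d)) p :=
  globIso (rightUnitorIso p)
    (by
      rw [← cancel_epi (rightUnitorIso p).inv, Iso.inv_hom_id_assoc]
      have h1 : compLact p (unit d) ≫ c.X ◁ ι p (unit d) =
        ι p (unit d) ≫ p.lact ▷ d.X ≫ (α_ _ _ _).hom := compLact_ι p (unit d)
      calc _ = (rightUnitorIso p).inv ≫ (compLact p (unit d) ≫ c.X ◁ ι p (unit d)) ≫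
              c.X ◁ (p.X ◁ ε[d.X] ≫ (ρ_ p.X).hom) := by
            rw [rightUnitorIso_hom]; monoidal
        _ = ((rightUnitorIso p).inv ≫ ι p (unit d)) ≫ p.lact ▷ d.X ≫ (α_ _ _ _).hom ≫
              c.X ◁ (p.X ◁ ε[d.X] ≫ (ρ_ p.X).hom) := by rw [h1]; monoidal
        _ = p.lact ≫ c.X ◁ (p.ract ≫ p.X ◁ ε[d.X] ≫ (ρ_ p.X).hom) := by
            rw [rightUnitorIso_inv_ι, ← reassoc_of% p.act_comm]; monoidal
        _ = _ := by rw [reassoc_of% p.ract_counit]; monoidal)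
    (by
      rw [← cancel_epi (rightUnitorIso p).inv, Iso.inv_hom_id_assoc]
      have h1 : compRact p (unit d) ≫ ι p (unit d) ▷ d.X =
        ι p (unit d) ≫ p.X ◁ Δ[d.X] ≫ (α_ _ _ _).inv := compRact_ι p (unit d)
      calc _ = (rightUnitorIso p).inv ≫ (compRact p (unit d) ≫ ι p (unit d) ▷ d.X) ≫
              (p.X ◁ ε[d.X] ≫ (ρ_ p.X).hom) ▷ d.X := by
            rw [rightUnitorIso_hom]; monoidal
        _ = ((rightUnitorIso p).inv ≫ ι p (unit d)) ≫ p.X ◁ (Δ[d.X] ≫ ε[d.X] ▷ d.X) ≫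
              (α_ _ _ _).inv ≫ (ρ_ p.X).hom ▷ d.X := by rw [h1]; monoidal
        _ = _ := by rw [rightUnitorIso_inv_ι, ComonObj.counit_comul]; monoidal)

/-! coherence -/

theorem compSqHom_id (p : Bicomod c d) (q : Bicomod d e) :
    compSqHom (Sq.id p) (Sq.id q) = 𝟙 (compX p q) := by
  have := (isEqualizerOf_ι p q).mono
  rw [← cancel_mono (ι p q), compSqHom_ι]
  simp [Sq.id]

theorem compSqHom_comp {c' d' c'' d'' e'' : Comon C} {p : Bicomod c d} {q : Bicomod d e}
    {p' : Bicomod c' d'} {q' : Bicomod d' e'} {p'' : Bicomod c'' d''} {q'' : Bicomod d'' e''}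
    {f : c ⟶ c'} {g : d ⟶ d'} {h : e ⟶ e'} {f' : c' ⟶ c''} {g' : d' ⟶ d''} {h' : e' ⟶ e''}
    (σ : Sq p p' f g) (τ : Sq q q' g h) (σ' : Sq p' p'' f' g') (τ' : Sq q' q'' g' h') :
    compSqHom (σ.comp σ') (τ.comp τ') = compSqHom σ τ ≫ compSqHom σ' τ' := by
  have := (isEqualizerOf_ι p'' q'').mono
  rw [← cancel_mono (ι p'' q''), Category.assoc, compSqHom_ι, compSqHom_ι,
    reassoc_of% (compSqHom_ι σ τ), MonoidalCategory.tensorHom_comp_tensorHom]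
  rfl

section
variable {a b c' d' e'' : Comon C} {p : Bicomod c d} {q : Bicomod d e} {r : Bicomod e a}
  {p' : Bicomod c' d'} {q' : Bicomod d' e'} {r' : Bicomod e' b}
  {f : c ⟶ c'} {g : d ⟶ d'} {h : e ⟶ e'} {k : a ⟶ b}

theorem compSqHom_ιL (σ : Sq p p' f g) (τ : Sq q q' g h) (υ : Sq r r' h k) :
    compSqHom (compSq σ τ) υ ≫ ιL p' q' r' = ιL p q r ≫ (σ.hom ⊗ₘ (τ.hom ⊗ₘ υ.hom)) := by
  have h1 : compSqHom (compSq σ τ) υ ≫ ι (p'.comp q') r' =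
    ι (p.comp q) r ≫ (compSqHom σ τ ⊗ₘ υ.hom) := compSqHom_ι (compSq σ τ) υ
  rw [ιL, ιL, reassoc_of% h1, MonoidalCategory.tensorHom_comp_whiskerRight_assoc, compSqHom_ι,
    ← MonoidalCategory.whiskerRight_comp_tensorHom_assoc,
    MonoidalCategory.associator_naturality]
  simp only [Category.assoc]

theorem compSqHom_ιR (σ : Sq p p' f g) (τ : Sq q q' g h) (υ : Sq r r' h k) :
    compSqHom σ (compSq τ υ) ≫ ιR p' q' r' = ιR p q r ≫ (σ.hom ⊗ₘ (τ.hom ⊗ₘ υ.hom)) := by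
  have h1 : compSqHom σ (compSq τ υ) ≫ ι p' (q'.comp r') =
    ι p (q.comp r) ≫ (σ.hom ⊗ₘ compSqHom τ υ) := compSqHom_ι σ (compSq τ υ)
  rw [ιR, ιR, reassoc_of% h1, MonoidalCategory.tensorHom_comp_whiskerLeft, compSqHom_ι,
    ← MonoidalCategory.whiskerLeft_comp_tensorHom, Category.assoc]

theorem assocIso_naturality (σ : Sq p p' f g) (τ : Sq q q' g h) (υ : Sq r r' h k) :
    compSqHom (compSq σ τ) υ ≫ (assocIso p' q' r').hom =
      (assocIso p q r).hom ≫ compSqHom σ (compSq τ υ) := by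
  have := mono_ιR p' q' r'
  rw [← cancel_mono (ιR p' q' r'), Category.assoc, Category.assoc, assocIso_hom_ιR, compSqHom_ιL,
    compSqHom_ιR, reassoc_of% (assocIso_hom_ιR p q r)]

theorem leftUnitorIso_naturality (σ : Sq p p' f g) :
    compSqHom (unitSq f) σ ≫ (leftUnitorIso p').hom = (leftUnitorIso p).hom ≫ σ.hom := by
  have h1 : compSqHom (unitSq f) σ ≫ ι (unit c') p' = ι (unit c) p ≫ (f.hom ⊗ₘ σ.hom) :=
    compSqHom_ι (unitSq f) σ
  rw [leftUnitorIso_hom, leftUnitorIso_hom, reassoc_of% h1,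
    MonoidalCategory.tensorHom_comp_whiskerRight_assoc, IsComonHom.hom_counit,
    MonoidalCategory.tensorHom_def, Category.assoc, MonoidalCategory.leftUnitor_naturality]
  simp only [Category.assoc]

theorem rightUnitorIso_naturality (σ : Sq p p' f g) :
    compSqHom σ (unitSq g) ≫ (rightUnitorIso p').hom = (rightUnitorIso p).hom ≫ σ.hom := by
  have h1 : compSqHom σ (unitSq g) ≫ ι p' (unit d') = ι p (unit d) ≫ (σ.hom ⊗ₘ g.hom) :=
    compSqHom_ι σ (unitSq g)
  rw [rightUnitorIso_hom, rightUnitorIso_hom, reassoc_of% h1,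
    MonoidalCategory.tensorHom_comp_whiskerLeft_assoc, IsComonHom.hom_counit,
    MonoidalCategory.tensorHom_def', Category.assoc, MonoidalCategory.rightUnitor_naturality]
  simp only [Category.assoc]

end

theorem assoc_pentagon {a : Comon C} (p : Bicomod c d) (q : Bicomod d e) (r : Bicomod e e')
    (s : Bicomod e' a) :
    (compSqHom (assoc p q r).hom (Sq.id s) ≫ (assocIso p (q.comp r) s).hom) ≫
        compSqHom (Sq.id p) (assoc q r s).hom =
      (assocIso (p.comp q) r s).hom ≫ (assocIso p q (r.comp s)).hom := by
  have hm1 := (isEqualizerOf_ι p (q.comp (r.comp s))).mono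
  have hm2 : Mono (p.X ◁ ιR q r s) := by
    have := ((isEqualizerOf_ι q (r.comp s)).whiskerLeft p.X).mono
    have := (((isEqualizerOf_ι r s).whiskerLeft q.X).whiskerLeft p.X).mono
    rw [ιR, MonoidalCategory.whiskerLeft_comp]
    exact mono_comp' ‹_› ‹_›
  have h1 : compSqHom (assoc p q r).hom (Sq.id s) ≫ ι (p.comp (q.comp r)) s =
      ι ((p.comp q).comp r) s ≫ (assocIso p q r).hom ▷ s.X :=
    (compSqHom_ι (assoc p q r).hom (Sq.id s)).trans
      (congrArg (_ ≫ ·) (MonoidalCategory.tensorHom_id _ _))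
  have h2 : compSqHom (Sq.id p) (assoc q r s).hom ≫ ι p (q.comp (r.comp s)) =
      ι p ((q.comp r).comp s) ≫ p.X ◁ (assocIso q r s).hom :=
    (compSqHom_ι (Sq.id p) (assoc q r s).hom).trans
      (congrArg (_ ≫ ·) (MonoidalCategory.id_tensorHom _ _))
  have h3 := assocIso_hom_ιR p (q.comp r) s
  have h4 := assocIso_hom_ιR p q (r.comp s)
  have h5 := assocIso_hom_ιR (p.comp q) r s
  rw [← cancel_mono (ι p (q.comp (r.comp s))), ← cancel_mono (p.X ◁ ιR q r s)]
  have hL : ((compSqHom (assoc p q r).hom (Sq.id s) ≫ (assocIso p (q.comp r) s).hom) ≫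
        compSqHom (Sq.id p) (assoc q r s).hom) ≫ ι p (q.comp (r.comp s)) ≫ p.X ◁ ιR q r s =
      ι ((p.comp q).comp r) s ≫ ιL p q r ▷ s.X ≫ (α_ _ _ _).hom ≫ p.X ◁ (α_ _ _ _).hom := by
    calc _ = compSqHom (assoc p q r).hom (Sq.id s) ≫ (assocIso p (q.comp r) s).hom ≫
            ι p ((q.comp r).comp s) ≫ p.X ◁ ((assocIso q r s).hom ≫ ιR q r s) := by
          simp only [Category.assoc, MonoidalCategory.whiskerLeft_comp, reassoc_of% h2]
      _ = compSqHom (assoc p q r).hom (Sq.id s) ≫ ((assocIso p (q.comp r) s).hom ≫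
            ιR p (q.comp r) s) ≫ p.X ◁ (ι q r ▷ s.X ≫ (α_ _ _ _).hom) := by
          rw [assocIso_hom_ιR, ιL, ιR]; monoidal
      _ = (compSqHom (assoc p q r).hom (Sq.id s) ≫ ι (p.comp (q.comp r)) s) ≫
            ι p (q.comp r) ▷ s.X ≫ (α_ _ _ _).hom ≫ p.X ◁ (ι q r ▷ s.X ≫ (α_ _ _ _).hom) := by
          rw [h3, ιL]; monoidal
      _ = ι ((p.comp q).comp r) s ≫ ((assocIso p q r).hom ≫ ιR p q r) ▷ s.X ≫ (α_ _ _ _).hom ≫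
            p.X ◁ (α_ _ _ _).hom := by
          rw [h1, ιR]; monoidal
      _ = _ := by rw [assocIso_hom_ιR]
  have hR : ((assocIso (p.comp q) r s).hom ≫ (assocIso p q (r.comp s)).hom) ≫
        ι p (q.comp (r.comp s)) ≫ p.X ◁ ιR q r s =
      ι ((p.comp q).comp r) s ≫ ιL p q r ▷ s.X ≫ (α_ _ _ _).hom ≫ p.X ◁ (α_ _ _ _).hom := by
    calc _ = (assocIso (p.comp q) r s).hom ≫ ((assocIso p q (r.comp s)).hom ≫
            ιR p q (r.comp s)) ≫ p.X ◁ q.X ◁ ι r s := by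
          simp only [ιR, Category.assoc, MonoidalCategory.whiskerLeft_comp]
      _ = (assocIso (p.comp q) r s).hom ≫ ι (p.comp q) (r.comp s) ≫
            (ι p q ▷ compX r s ≫ (p.X ⊗ q.X) ◁ ι r s) ≫ (α_ _ _ _).hom := by
          rw [h4, ιL]; monoidal
      _ = ((assocIso (p.comp q) r s).hom ≫ ιR (p.comp q) r s) ≫ ι p q ▷ (r.X ⊗ s.X) ≫
            (α_ _ _ _).hom := by
          rw [← MonoidalCategory.whisker_exchange, ιR]; monoidal
      _ = _ := by rw [h5, ιL, ιL]; monoidal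
  simpa only [Category.assoc] using hL.trans hR.symm

theorem assoc_triangle (p : Bicomod c d) (q : Bicomod d e) :
    (assocIso p (unit d) q).hom ≫ compSqHom (Sq.id p) (leftUnitor q).hom =
      compSqHom (rightUnitor p).hom (Sq.id q) := by
  have := (isEqualizerOf_ι p q).mono
  have h1 : compSqHom (Sq.id p) (leftUnitor q).hom ≫ ι p q =
      ι p ((unit d).comp q) ≫ p.X ◁ (leftUnitorIso q).hom :=
    (compSqHom_ι (Sq.id p) (leftUnitor q).hom).trans
      (congrArg (_ ≫ ·) (MonoidalCategory.id_tensorHom _ _))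
  have h2 : compSqHom (rightUnitor p).hom (Sq.id q) ≫ ι p q =
      ι (p.comp (unit d)) q ≫ (rightUnitorIso p).hom ▷ q.X :=
    (compSqHom_ι (rightUnitor p).hom (Sq.id q)).trans
      (congrArg (_ ≫ ·) (MonoidalCategory.tensorHom_id _ _))
  rw [← cancel_mono (ι p q), Category.assoc, h1, h2, leftUnitorIso_hom, rightUnitorIso_hom]
  calc _ = ((assocIso p (unit d) q).hom ≫ ιR p (unit d) q) ≫
          p.X ◁ (ε[d.X] ▷ q.X ≫ (λ_ q.X).hom) := by rw [ιR]; monoidal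
    _ = _ := by rw [assocIso_hom_ιR, ιL]; monoidal

end Composition

/-- The pseudo-double category of comonoids, comonoid homomorphisms, bicomodules and squares. -/
noncomputable def double (C : Type u) [Category.{v} C] [MonoidalCategory C] [HasEqualizers C]
    [TensorPreservesEqualizers C] : PseudoDoubleCat where
  toDoubleBase := base C
  hid := unit
  hidSq := unitSq
  hidSq_id _ := rfl
  hidSq_comp _ _ := rfl
  hcomp := comp
  hcompSq := compSq
  hcompSq_vid p q := Sq.ext (compSqHom_id p q)
  hcompSq_vcomp σ τ σ' τ' := Sq.ext (compSqHom_comp σ τ σ' τ')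
  assoc := assoc
  leftUnitor := leftUnitor
  rightUnitor := rightUnitor
  assoc_naturality σ τ υ := Sq.hext ((Category.comp_id _).trans (Category.id_comp _).symm)
    ((Category.comp_id _).trans (Category.id_comp _).symm) (assocIso_naturality σ τ υ)
  leftUnitor_naturality σ := Sq.hext ((Category.comp_id _).trans (Category.id_comp _).symm)
    ((Category.comp_id _).trans (Category.id_comp _).symm) (leftUnitorIso_naturality σ)
  rightUnitor_naturality σ := Sq.hext ((Category.comp_id _).trans (Category.id_comp _).symm)
    ((Category.comp_id _).trans (Category.id_comp _).symm) (rightUnitorIso_naturality σ)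
  pentagon p q r s := Sq.hext
    (congrArg (· ≫ _) (Category.id_comp _)) (congrArg (· ≫ _) (Category.id_comp _))
    (assoc_pentagon p q r s)
  triangle p q := Sq.hext (Category.id_comp _) (Category.id_comp _) (assoc_triangle p q)

end Bicomod

namespace EffHandler

/-- The `(c, d)`-bicomodule `s ◁ d` of an effects handler `(s, φ)`, with coactions
`c ◁ s ◁ d ← s ◁ d ◁ d ← s ◁ d → s ◁ d ◁ d`. -/
abbrev toBicomod {c d : Comon C} (s : EffHandler c d) : Bicomod c d where
  X := s.X ⊗ d.X
  lact := s.X ◁ Δ[d.X] ≫ (α_ s.X d.X d.X).inv ≫ s.act ▷ d.X ≫ (α_ c.X s.X d.X).hom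
  ract := s.X ◁ Δ[d.X] ≫ (α_ s.X d.X d.X).inv
  lact_counit := by
    rw [← cancel_mono (λ_ _).hom]
    calc _ = s.X ◁ Δ[d.X] ≫ (α_ s.X d.X d.X).inv ≫
            (s.act ≫ ε[c.X] ▷ s.X ≫ (λ_ s.X).hom) ▷ d.X := by monoidal
      _ = s.X ◁ (Δ[d.X] ≫ ε[d.X] ▷ d.X) ≫ s.X ◁ (λ_ d.X).hom := by
          rw [s.act_counit]; monoidal
      _ = _ := by rw [ComonObj.counit_comul]; monoidal
  lact_comul := by
    calc _ = s.X ◁ Δ[d.X] ≫ (α_ s.X d.X d.X).inv ≫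
            (s.act ≫ Δ[c.X] ▷ s.X ≫ (α_ c.X c.X s.X).hom) ▷ d.X ≫ (α_ _ _ _).hom ≫
              c.X ◁ (α_ _ _ _).hom := by monoidal
      _ = s.X ◁ (Δ[d.X] ≫ Δ[d.X] ▷ d.X ≫ (α_ _ _ _).hom) ≫ (α_ s.X d.X (d.X ⊗ d.X)).inv ≫
            s.act ▷ (d.X ⊗ d.X) ≫ (α_ _ _ _).hom ≫ c.X ◁ (α_ _ _ _).inv ≫
            c.X ◁ (s.act ▷ d.X ≫ (α_ _ _ _).hom) := by
          rw [s.act_comul]; monoidal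
      _ = s.X ◁ Δ[d.X] ≫ (α_ s.X d.X d.X).inv ≫ ((s.X ⊗ d.X) ◁ Δ[d.X] ≫
            s.act ▷ (d.X ⊗ d.X)) ≫ (α_ _ _ _).hom ≫ c.X ◁ (α_ _ _ _).inv ≫
            c.X ◁ (s.act ▷ d.X ≫ (α_ _ _ _).hom) := by
          rw [← ComonObj.comul_assoc]; monoidal
      _ = _ := by rw [MonoidalCategory.whisker_exchange]; monoidal
  ract_counit := by
    calc _ = s.X ◁ (Δ[d.X] ≫ d.X ◁ ε[d.X]) ≫ (α_ _ _ _).inv := by monoidal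
      _ = _ := by rw [ComonObj.comul_counit]; monoidal
  ract_comul := by
    calc _ = s.X ◁ (Δ[d.X] ≫ d.X ◁ Δ[d.X]) ≫ (α_ _ _ _).inv := by monoidal
      _ = _ := by rw [ComonObj.comul_assoc]; monoidal
  act_comm := by
    calc _ = s.X ◁ Δ[d.X] ≫ (α_ s.X d.X d.X).inv ≫ (s.act ▷ d.X ≫
            (c.X ⊗ s.X) ◁ Δ[d.X]) ≫ (α_ _ _ _).hom ≫ c.X ◁ (α_ _ _ _).inv := by monoidal
      _ = s.X ◁ (Δ[d.X] ≫ d.X ◁ Δ[d.X]) ≫ (α_ _ _ _).inv ≫ s.act ▷ (d.X ⊗ d.X) ≫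
            (α_ _ _ _).hom ≫ c.X ◁ (α_ _ _ _).inv := by
          rw [← MonoidalCategory.whisker_exchange]; monoidal
      _ = _ := by rw [ComonObj.comul_assoc]; monoidal

end EffHandler
end Bicomodules

/-! ## The pseudo-double categories of the statement -/

/-- The pseudo-double category `Cat♯` of comonoids in polynomials, comonoid homomorphisms,
bicomodules and squares. -/
noncomputable abbrev CatSharp : PseudoDoubleCat :=
  Bicomod.double PolyCat.{u}

/-- The pseudo-double category `Eff` of comonoids in polynomials, comonoid homomorphisms, effects
handlers and squares. -/
noncomputable abbrev Eff : PseudoDoubleCat :=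
  EffHandler.double PolyCat.{u}

/-! Everything is governed by the map `s ◁ d → s` that applies the counit of `d` (`dropCounit`). The
right `d`-comodule `s ◁ d` is the cofree one on `s`, and cotensoring a cofree comodule over `d`
cancels `d`: for every `(d, e)`-bicomodule `q` there is an isomorphism `(s ◁ d) ◁_d q ≅ s ◁ q`
(`compXIso`). Forwards it is the inclusion of the equalizer followed by the counit. Backwards it is
induced by the left coaction of `q`, which lands in the equalizer by coassociativity; the two are
inverse by the counit laws.

For `q = t ◁ e` this is the comparison of composites. Carried over to `s ◁ q`, the left coaction
first coacts on `q` and then applies the handler `s` (`compLact_compXIso`), while the right coaction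
is that of `q` (`compRact_compXIso`). This is exactly what composition of handlers prescribes. Since
the comparison is an inclusion into a plain composite followed by counits, each coherence equation
can be checked in plain composites. Only the one for the right unit calls on the counit laws again.
The argument works in any monoidal category with equalizers that are preserved by tensoring.

For faithfulness, `dropCounit` is natural in squares: `γ ◁ β` followed by the counit of `d'` is the
counit of `d` followed by `γ`. So `γ ◁ β` determines `γ` as soon as `s ◁ d → s` is epi, and for
polynomials this holds when `d` has a position (`dropCounit_epi`).

For the essential image, the right coaction of any bicomodule `p` is a section of `p ◁ d → p`
(`ract_dropCounit`). If that map is invertible, then `p ≅ p ◁ d`, and the handler on `p` that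
discards `d` and then coacts on the left has a bicomodule isomorphic to `p` (`ofBicomodGlobIso`).
For `d = y` the map is the right unitor. For `d = 0` the existence of a right coaction leaves `p`
without directions, so that `p ◁ 0` and `p` agree. -/

namespace EffHandler

/-! ### Discarding `d` by its counit; bicomodules from handlers and handlers from bicomodules. -/

section Monoidal
variable {C : Type u} [Category.{v} C] [MonoidalCategory C]

/-- The morphism `s ◁ d → s` given by the counit of `d`. -/
def dropCounit (X : C) (d : Comon C) : X ⊗ d.X ⟶ X :=
  X ◁ ε[d.X] ≫ (ρ_ X).hom

/-- This is the left counit law of `d`, whiskered by `X`. It lets a copy of `d` be created and the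
inner copy discarded at no cost, and most cancellations below come down to it. -/
theorem comul_dropCounit_whiskerRight (X : C) (d : Comon C) :
    X ◁ Δ[d.X] ≫ (α_ X d.X d.X).inv ≫ dropCounit X d ▷ d.X = 𝟙 _ := by
  calc _ = X ◁ (Δ[d.X] ≫ ε[d.X] ▷ d.X ≫ (λ_ d.X).hom) := by
        simp only [dropCounit]; monoidal
    _ = _ := by rw [ComonObj.counit_comul_assoc]; simp

/-- Comonoid homomorphisms preserve counits, so `g` disappears. This yields both the naturality of
the comparison of composites and faithfulness. -/
theorem dropCounit_naturality {X Y : C} (f : X ⟶ Y) {d d' : Comon C} (g : d ⟶ d') :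
    (f ⊗ₘ g.hom) ≫ dropCounit Y d' = dropCounit X d ≫ f := by
  rw [dropCounit, MonoidalCategory.tensorHom_comp_whiskerLeft_assoc, IsComonHom.hom_counit,
    MonoidalCategory.tensorHom_def', Category.assoc, MonoidalCategory.rightUnitor_naturality,
    dropCounit, Category.assoc]

theorem whiskerRight_dropCounit {X Y : C} (f : X ⟶ Y) (d : Comon C) :
    f ▷ d.X ≫ dropCounit Y d = dropCounit X d ≫ f := by
  simpa using dropCounit_naturality f (𝟙 d)

variable {c d e : Comon C}

/-- The structure map of a handler can be read off from its bicomodule: the coaction acts with one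
copy of `d` and keeps the other, and the right counit law removes the copy that was kept. -/
theorem lact_dropCounit (s : EffHandler c d) :
    s.toBicomod.lact ≫ c.X ◁ dropCounit s.X d = s.act := by
  calc _ = s.X ◁ Δ[d.X] ≫ (α_ s.X d.X d.X).inv ≫
          s.act ▷ d.X ≫ dropCounit (c.X ⊗ s.X) d := by
        simp only [dropCounit]; monoidal
    _ = s.X ◁ (Δ[d.X] ≫ d.X ◁ ε[d.X]) ≫ (α_ _ _ _).inv ≫ (ρ_ _).hom ≫ s.act := by
        rw [whiskerRight_dropCounit]; simp only [dropCounit]; monoidal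
    _ = _ := by rw [ComonObj.comul_counit]; monoidal

/-- Only `t` meets the comultiplication of `e`, so the coaction of the composite is that of `t`
followed by the action of `s`, up to coherence. This is the shape that `compLact_compXIso` produces.
-/
theorem lact_comp (s : EffHandler c d) (t : EffHandler d e) :
    (s.comp t).toBicomod.lact = (α_ s.X t.X e.X).hom ≫ s.X ◁ t.toBicomod.lact ≫
      (α_ s.X d.X (t.X ⊗ e.X)).inv ≫ s.act ▷ (t.X ⊗ e.X) ≫ (α_ c.X s.X (t.X ⊗ e.X)).hom ≫
        c.X ◁ (α_ s.X t.X e.X).inv := by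
  dsimp only
  monoidal

/-- The square `γ ◁ β` between the bicomodules of effects handlers. -/
def toBicomodSq {c' d' : Comon C} {s : EffHandler c d} {s' : EffHandler c' d'}
    {f : c ⟶ c'} {g : d ⟶ d'} (σ : Sq s s' f g) :
    Bicomod.Sq s.toBicomod s'.toBicomod f g where
  hom := σ.hom ⊗ₘ g.hom
  lact_hom := by
    have h := σ.comm
    have hg : Δ[d.X] ≫ (g.hom ⊗ₘ g.hom) = g.hom ≫ Δ[d'.X] := (IsComonHom.hom_comul g.hom).symm
    calc _ = s.X ◁ Δ[d.X] ≫ (α_ _ _ _).inv ≫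
            ((s.act ≫ (f.hom ⊗ₘ σ.hom)) ⊗ₘ g.hom) ≫ (α_ _ _ _).hom := by
          simp only [Category.assoc, ← MonoidalCategory.associator_naturality,
            MonoidalCategory.whiskerRight_comp_tensorHom_assoc]
      _ = (σ.hom ⊗ₘ (Δ[d.X] ≫ (g.hom ⊗ₘ g.hom))) ≫ (α_ _ _ _).inv ≫ s'.act ▷ d'.X ≫
            (α_ _ _ _).hom := by
          rw [h, ← MonoidalCategory.tensorHom_comp_whiskerRight, Category.assoc,
            ← MonoidalCategory.associator_inv_naturality_assoc,
            MonoidalCategory.whiskerLeft_comp_tensorHom_assoc]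
      _ = _ := by
          rw [hg, ← MonoidalCategory.tensorHom_comp_whiskerLeft, Category.assoc]
  ract_hom := by
    have hg : Δ[d.X] ≫ (g.hom ⊗ₘ g.hom) = g.hom ≫ Δ[d'.X] := (IsComonHom.hom_comul g.hom).symm
    dsimp only
    rw [Category.assoc, ← MonoidalCategory.associator_inv_naturality,
      MonoidalCategory.whiskerLeft_comp_tensorHom_assoc, hg,
      ← MonoidalCategory.tensorHom_comp_whiskerLeft, Category.assoc]

/-- The handler on the carrier of a bicomodule that discards the right coaction. -/
def ofBicomod (p : Bicomod c d) : EffHandler c d where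
  X := p.X
  act := dropCounit p.X d ≫ p.lact
  act_counit := by
    rw [Category.assoc, reassoc_of% p.lact_counit, Iso.inv_hom_id, Category.comp_id, dropCounit]
  act_comul := by
    have h1 := comul_dropCounit_whiskerRight p.X d
    have h2 := whiskerRight_dropCounit p.lact d
    calc _ = (dropCounit p.X d ≫ p.lact) ≫ c.X ◁ p.lact := by
          rw [Category.assoc, p.lact_comul, Category.assoc]
      _ = p.lact ▷ d.X ≫ (α_ c.X p.X d.X).hom ≫ c.X ◁ dropCounit p.X d ≫ c.X ◁ p.lact := by
          rw [← h2]; simp only [dropCounit]; monoidal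
      -- The other side of the axiom duplicates `d` and lets each of the two actions discard one
      -- copy, so an identity is expanded here by the counit law to create the second copy.
      _ = (p.X ◁ Δ[d.X] ≫ (α_ p.X d.X d.X).inv ≫ dropCounit p.X d ▷ d.X) ≫ p.lact ▷ d.X ≫
            (α_ c.X p.X d.X).hom ≫ c.X ◁ dropCounit p.X d ≫ c.X ◁ p.lact := by
          rw [h1, Category.id_comp]
      _ = _ := by monoidal

/-- The copy of `d` created by the comultiplication is the one that the handler discards at once.
What remains is the left coaction of `p`, with `d` as a spectator. -/
theorem lact_ofBicomod (p : Bicomod c d) :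
    (ofBicomod p).toBicomod.lact = p.lact ▷ d.X ≫ (α_ c.X p.X d.X).hom := by
  have h1 := comul_dropCounit_whiskerRight p.X d
  calc _ = (p.X ◁ Δ[d.X] ≫ (α_ p.X d.X d.X).inv ≫ dropCounit p.X d ▷ d.X) ≫ p.lact ▷ d.X ≫
            (α_ c.X p.X d.X).hom := by dsimp only [ofBicomod]; monoidal
    _ = _ := by rw [h1, Category.id_comp]

/-- The counit law of the right coaction makes it a section of `p ◁ d → p`, whatever `d` is. Only
the other composite needs an assumption on `d`. -/
theorem ract_dropCounit (p : Bicomod c d) : p.ract ≫ dropCounit p.X d = 𝟙 _ := by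
  rw [dropCounit, reassoc_of% p.ract_counit, Iso.inv_hom_id]

/-- A bicomodule whose right coaction is invertible comes from an effects handler. -/
def ofBicomodGlobIso (p : Bicomod c d) (h : dropCounit p.X d ≫ p.ract = 𝟙 _) :
    (Bicomod.base C).GlobIso (a := c) (b := d) (ofBicomod p).toBicomod p :=
  Bicomod.globIso ⟨dropCounit p.X d, p.ract, h, ract_dropCounit p⟩
    (by
      rw [lact_ofBicomod]
      -- By coherence, discarding `d` inside `c ◁ (p ◁ d)` is discarding it from `(c ◁ p) ◁ d`. The
      -- claim is then naturality of `dropCounit` along the left coaction.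
      exact (by simp only [dropCounit]; monoidal :
        _ = p.lact ▷ d.X ≫ dropCounit (c.X ⊗ p.X) d).trans (whiskerRight_dropCounit p.lact d))
    (by
      -- Both sides are identities: the left one by the counit law of `d`, the right one by `h`.
      change (p.X ◁ Δ[d.X] ≫ (α_ _ _ _).inv) ≫ dropCounit p.X d ▷ d.X = dropCounit p.X d ≫ p.ract
      rw [Category.assoc, comul_dropCounit_whiskerRight, h])

end Monoidal

/-! ### Cotensoring with a cofree comodule, and the comparison of composites. -/

section Equalizers
variable {C : Type u} [Category.{v} C] [MonoidalCategory C] [HasEqualizers C]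
  {c d e : Comon C}

open Bicomod

/-- Coassociativity of the left coaction of `q` says precisely that coacting on `q` lands in the
equalizer. -/
theorem exists_compXInv (s : EffHandler c d) (q : Bicomod d e) :
    ∃ l : s.X ⊗ q.X ⟶ compX s.toBicomod q,
      l ≫ ι s.toBicomod q = s.X ◁ q.lact ≫ (α_ s.X d.X q.X).inv := by
  refine (isEqualizerOf_ι s.toBicomod q).exists_lift _ ?_
  have h := q.lact_comul
  calc _ = s.X ◁ (q.lact ≫ Δ[d.X] ▷ q.X ≫ (α_ _ _ _).hom) ≫ (α_ _ _ _).inv := by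
        simp only [parL]; monoidal
    _ = _ := by rw [h]; simp only [parR]; monoidal

/-- The isomorphism `(s ◁ d) ◁_d q ≅ s ◁ q`. -/
noncomputable def compXIso (s : EffHandler c d) (q : Bicomod d e) :
    compX s.toBicomod q ≅ s.X ⊗ q.X where
  hom := ι s.toBicomod q ≫ dropCounit s.X d ▷ q.X
  inv := (exists_compXInv s q).choose
  hom_inv_id := by
    have := (isEqualizerOf_ι s.toBicomod q).mono
    have hi : ι s.toBicomod q ≫ (s.X ◁ Δ[d.X] ≫ (α_ _ _ _).inv) ▷ q.X ≫ (α_ _ _ _).hom =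
        ι s.toBicomod q ≫ (s.X ⊗ d.X) ◁ q.lact := ι_condition s.toBicomod q
    -- In the plain composite, the equalizer condition trades the coaction on `q` for the
    -- comultiplication of `d`, and the counit law then cancels the copy so created.
    rw [← cancel_mono (ι s.toBicomod q), Category.assoc, (exists_compXInv s q).choose_spec]
    calc _ = ι s.toBicomod q ≫ (dropCounit s.X d ▷ q.X ≫ s.X ◁ q.lact) ≫ (α_ _ _ _).inv := by
          simp only [Category.assoc]
      _ = (ι s.toBicomod q ≫ (s.X ⊗ d.X) ◁ q.lact) ≫ dropCounit s.X d ▷ (d.X ⊗ q.X) ≫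
            (α_ _ _ _).inv := by
          rw [← MonoidalCategory.whisker_exchange]; simp only [Category.assoc]
      _ = ι s.toBicomod q ≫ (s.X ◁ Δ[d.X] ≫ (α_ _ _ _).inv ≫ dropCounit s.X d ▷ d.X) ▷ q.X := by
          rw [← hi]; monoidal
      _ = _ := by rw [comul_dropCounit_whiskerRight]; simp
  inv_hom_id := by
    rw [reassoc_of% (exists_compXInv s q).choose_spec]
    calc _ = s.X ◁ (q.lact ≫ ε[d.X] ▷ q.X ≫ (λ_ q.X).hom) := by
          simp only [dropCounit]; monoidal
      _ = _ := by rw [reassoc_of% q.lact_counit]; simp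

theorem compXIso_hom (s : EffHandler c d) (q : Bicomod d e) :
    (compXIso s q).hom = ι s.toBicomod q ≫ dropCounit s.X d ▷ q.X :=
  rfl

theorem compXIso_inv_ι (s : EffHandler c d) (q : Bicomod d e) :
    (compXIso s q).inv ≫ ι s.toBicomod q = s.X ◁ q.lact ≫ (α_ s.X d.X q.X).inv :=
  (exists_compXInv s q).choose_spec

/-- The inclusion of the equalizer factors through the coaction of `q`. Maps out of the equalizer
can thus be computed on `s ◁ q`. -/
theorem compXIso_hom_lact (s : EffHandler c d) (q : Bicomod d e) :
    (compXIso s q).hom ≫ s.X ◁ q.lact ≫ (α_ s.X d.X q.X).inv = ι s.toBicomod q := by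
  rw [← compXIso_inv_ι, Iso.hom_inv_id_assoc]

variable [TensorPreservesEqualizers C]

/-- Discarding the remaining `d` turns the coaction of `s ◁ d` into the structure map of `s` by
`lact_dropCounit`. The `d` on which this map acts is the one that `q` emits, by `compXIso_hom_lact`.
-/
theorem compLact_compXIso (s : EffHandler c d) (q : Bicomod d e) :
    compLact s.toBicomod q ≫ c.X ◁ (compXIso s q).hom =
      (compXIso s q).hom ≫ s.X ◁ q.lact ≫ (α_ s.X d.X q.X).inv ≫ s.act ▷ q.X ≫
        (α_ c.X s.X q.X).hom := by
  have h := compXIso_hom_lact s q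
  have h1 := compLact_ι s.toBicomod q
  have h2 := lact_dropCounit s
  calc _ = (compLact s.toBicomod q ≫ c.X ◁ ι s.toBicomod q) ≫ c.X ◁ dropCounit s.X d ▷ q.X := by
        rw [compXIso_hom]; simp only [Category.assoc, MonoidalCategory.whiskerLeft_comp]
    _ = ι s.toBicomod q ≫ (s.toBicomod.lact ≫ c.X ◁ dropCounit s.X d) ▷ q.X ≫
          (α_ _ _ _).hom := by
        rw [h1]
        simp only [Category.assoc, MonoidalCategory.comp_whiskerRight,
          MonoidalCategory.associator_naturality_middle]
    _ = ((compXIso s q).hom ≫ s.X ◁ q.lact ≫ (α_ s.X d.X q.X).inv) ≫ s.act ▷ q.X ≫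
          (α_ _ _ _).hom := by rw [h2, h]
    _ = _ := by simp only [Category.assoc]

/-- The right coaction touches only `q` and the counit only `s ◁ d`, so the two commute by
interchange. -/
theorem compRact_compXIso (s : EffHandler c d) (q : Bicomod d e) :
    compRact s.toBicomod q ≫ (compXIso s q).hom ▷ e.X =
      (compXIso s q).hom ≫ s.X ◁ q.ract ≫ (α_ s.X q.X e.X).inv := by
  have h1 := compRact_ι s.toBicomod q
  calc _ = (compRact s.toBicomod q ≫ ι s.toBicomod q ▷ e.X) ≫
          dropCounit s.X d ▷ q.X ▷ e.X := by
        rw [compXIso_hom]; simp only [Category.assoc, MonoidalCategory.comp_whiskerRight]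
    _ = ι s.toBicomod q ≫ ((s.X ⊗ d.X) ◁ q.ract ≫ dropCounit s.X d ▷ (q.X ⊗ e.X)) ≫
          (α_ _ _ _).inv := by
        rw [h1]; monoidal
    _ = _ := by
        rw [MonoidalCategory.whisker_exchange, compXIso_hom]; simp only [Category.assoc]

/-- The comparison `(s ◁ d) ◁_d (t ◁ e) ≅ (s ◁ t) ◁ e` of composites. -/
noncomputable def compComparison (s : EffHandler c d) (t : EffHandler d e) :
    (Bicomod.base C).GlobIso (a := c) (b := e) (s.toBicomod.comp t.toBicomod)
      (s.comp t).toBicomod :=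
  Bicomod.globIso (compXIso s t.toBicomod ≪≫ (α_ s.X t.X e.X).symm)
    (by
      have h := compLact_compXIso s t.toBicomod
      -- With the coaction of the composite handler in this form, it agrees with `h` for `q = t ◁ e`
      -- up to reassociation.
      rw [lact_comp]
      simp only [Iso.trans_hom, Iso.symm_hom, MonoidalCategory.whiskerLeft_comp, Category.assoc,
        Iso.inv_hom_id_assoc]
      rw [reassoc_of% h]
      simp only [MonoidalCategory.whiskerLeft_comp, Category.assoc])
    (by
      have h := compRact_compXIso s t.toBicomod
      simp only [Iso.trans_hom, Iso.symm_hom, MonoidalCategory.comp_whiskerRight, Category.assoc]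
      rw [reassoc_of% h]
      monoidal)

/-- The comparison `c ≅ y ◁ c` of horizontal identities. -/
def unitComparison (c : Comon C) :
    (Bicomod.base C).GlobIso (a := c) (b := c) (Bicomod.unit c) (unit c).toBicomod :=
  Bicomod.globIso (λ_ c.X).symm
    (by dsimp only [Iso.symm_hom]; monoidal)
    (by dsimp only [Iso.symm_hom]; monoidal)

end Equalizers

/-! ### Coherence of the comparisons, and the pseudo-double functor. -/

section Functor
variable {C : Type u} [Category.{v} C] [MonoidalCategory C] [HasEqualizers C]
  [TensorPreservesEqualizers C]

open Bicomod

theorem compComparison_hom_hom {c d e : Comon C} (s : EffHandler c d) (t : EffHandler d e) :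
    (compComparison s t).hom.hom = ι s.toBicomod t.toBicomod ≫
      dropCounit s.X d ▷ (t.X ⊗ e.X) ≫ (α_ s.X t.X e.X).inv :=
  Category.assoc _ _ _

/-- The comparison is made of the inclusion of the equalizer, a counit and an associator, and each
of these is natural in squares. -/
theorem compComparison_naturality {c d e c' d' e' : Comon C} {s : EffHandler c d}
    {t : EffHandler d e} {s' : EffHandler c' d'} {t' : EffHandler d' e'} {f : c ⟶ c'}
    {g : d ⟶ d'} {h : e ⟶ e'} (σ : Sq s s' f g) (τ : Sq t t' g h) :
    compSqHom (toBicomodSq σ) (toBicomodSq τ) ≫ (compComparison s' t').hom.hom =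
      (compComparison s t).hom.hom ≫ (toBicomodSq (compSq σ τ)).hom := by
  have h1 := compSqHom_ι (toBicomodSq σ) (toBicomodSq τ)
  have h2 := dropCounit_naturality σ.hom g
  rw [compComparison_hom_hom, compComparison_hom_hom, reassoc_of% h1]
  change ι s.toBicomod t.toBicomod ≫ ((σ.hom ⊗ₘ g.hom) ⊗ₘ (τ.hom ⊗ₘ h.hom)) ≫ _ =
    _ ≫ ((σ.hom ⊗ₘ τ.hom) ⊗ₘ h.hom)
  rw [MonoidalCategory.tensorHom_comp_whiskerRight_assoc, h2, Category.assoc, Category.assoc,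
    ← MonoidalCategory.whiskerRight_comp_tensorHom_assoc,
    MonoidalCategory.associator_inv_naturality]

/-- Both sides include the triple composite into `(p ◁ b) ◁ ((q ◁ c) ◁ (r ◁ d))` and then discard
`b` and `c`; they differ only in which of the two goes first. -/
theorem compComparison_assoc {a b c d : Comon C} (p : EffHandler a b) (q : EffHandler b c)
    (r : EffHandler c d) :
    (compSqHom (compComparison p q).hom (Bicomod.Sq.id r.toBicomod) ≫
        (compComparison (p.comp q) r).hom.hom) ≫ ((α_ p.X q.X r.X).hom ⊗ₘ 𝟙 d.X) =
      ((assocIso p.toBicomod q.toBicomod r.toBicomod).hom ≫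
        compSqHom (Bicomod.Sq.id p.toBicomod) (compComparison q r).hom) ≫
          (compComparison p (q.comp r)).hom.hom := by
  have h1 : compSqHom (compComparison p q).hom (Bicomod.Sq.id r.toBicomod) ≫
      ι (p.comp q).toBicomod r.toBicomod =
      ι (p.toBicomod.comp q.toBicomod) r.toBicomod ≫
        (compComparison p q).hom.hom ▷ (r.X ⊗ d.X) :=
    (compSqHom_ι _ _).trans (congrArg (_ ≫ ·) (MonoidalCategory.tensorHom_id _ _))
  have h2 : compSqHom (Bicomod.Sq.id p.toBicomod) (compComparison q r).hom ≫
      ι p.toBicomod (q.comp r).toBicomod =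
      ι p.toBicomod (q.toBicomod.comp r.toBicomod) ≫
        (p.X ⊗ b.X) ◁ (compComparison q r).hom.hom :=
    (compSqHom_ι _ _).trans (congrArg (_ ≫ ·) (MonoidalCategory.id_tensorHom _ _))
  have h3 := assocIso_hom_ιR p.toBicomod q.toBicomod r.toBicomod
  rw [compComparison_hom_hom, compComparison_hom_hom]
  rw [compComparison_hom_hom] at h1 h2
  calc _ = (compSqHom (compComparison p q).hom (Bicomod.Sq.id r.toBicomod) ≫
            ι (p.comp q).toBicomod r.toBicomod) ≫
          dropCounit (p.X ⊗ q.X) c ▷ (r.X ⊗ d.X) ≫ (α_ (p.X ⊗ q.X) r.X d.X).inv ≫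
            (α_ p.X q.X r.X).hom ▷ d.X := by
        simp only [Category.assoc, MonoidalCategory.tensorHom_id]
    _ = ιL p.toBicomod q.toBicomod r.toBicomod ≫
          dropCounit p.X b ▷ ((q.X ⊗ c.X) ⊗ (r.X ⊗ d.X)) ≫
            p.X ◁ (dropCounit q.X c ▷ (r.X ⊗ d.X)) ≫ p.X ◁ (α_ _ _ _).inv ≫
              (α_ _ _ _).inv := by
        rw [h1]; simp only [ιL, dropCounit]; monoidal
    _ = ((assocIso p.toBicomod q.toBicomod r.toBicomod).hom ≫
          ιR p.toBicomod q.toBicomod r.toBicomod) ≫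
          (p.X ⊗ b.X) ◁ (dropCounit q.X c ▷ (r.X ⊗ d.X) ≫ (α_ _ _ _).inv) ≫
            dropCounit p.X b ▷ ((q.X ⊗ r.X) ⊗ d.X) ≫ (α_ _ _ _).inv := by
        -- The associator of bicomodules identifies the two inclusions, and interchange swaps the
        -- order in which `b` and `c` are discarded.
        rw [h3, MonoidalCategory.whisker_exchange_assoc]
        simp only [Category.assoc, MonoidalCategory.whiskerLeft_comp]
    _ = (assocIso p.toBicomod q.toBicomod r.toBicomod).hom ≫
          (compSqHom (Bicomod.Sq.id p.toBicomod) (compComparison q r).hom ≫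
            ι p.toBicomod (q.comp r).toBicomod) ≫
              dropCounit p.X b ▷ ((q.X ⊗ r.X) ⊗ d.X) ≫ (α_ _ _ _).inv := by
        rw [h2]; simp only [ιR, Category.assoc, MonoidalCategory.whiskerLeft_comp]
    _ = _ := by simp only [Category.assoc]

theorem compComparison_leftUnitor {c d : Comon C} (p : EffHandler c d) :
    (compSqHom (unitComparison c).hom (Bicomod.Sq.id p.toBicomod) ≫
        (compComparison (unit c) p).hom.hom) ≫ ((λ_ p.X).hom ⊗ₘ 𝟙 d.X) =
      (leftUnitorIso p.toBicomod).hom := by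
  have h1 : compSqHom (unitComparison c).hom (Bicomod.Sq.id p.toBicomod) ≫
      ι (unit c).toBicomod p.toBicomod =
      ι (Bicomod.unit c) p.toBicomod ≫ (λ_ c.X).inv ▷ (p.X ⊗ d.X) :=
    (compSqHom_ι _ _).trans (congrArg (_ ≫ ·) (MonoidalCategory.tensorHom_id _ _))
  rw [compComparison_hom_hom, reassoc_of% h1, leftUnitorIso_hom]
  simp only [dropCounit]
  monoidal

/-- Unlike on the left, coherence does not suffice: in `(p ◁ d) ◁ d` the comparison discards the
inner copy of `d`, the unitor of bicomodules the outer one. -/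
theorem compComparison_rightUnitor {c d : Comon C} (p : EffHandler c d) :
    (compSqHom (Bicomod.Sq.id p.toBicomod) (unitComparison d).hom ≫
        (compComparison p (unit d)).hom.hom) ≫ ((ρ_ p.X).hom ⊗ₘ 𝟙 d.X) =
      (rightUnitorIso p.toBicomod).hom := by
  have h1 : compSqHom (Bicomod.Sq.id p.toBicomod) (unitComparison d).hom ≫
      ι p.toBicomod (unit d).toBicomod =
      ι p.toBicomod (Bicomod.unit d) ≫ (p.X ⊗ d.X) ◁ (λ_ d.X).inv :=
    (compSqHom_ι _ _).trans (congrArg (_ ≫ ·) (MonoidalCategory.id_tensorHom _ _))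
  -- On the equalizer it does not matter which copy is discarded: the inclusion factors through the
  -- comultiplication of `d`, and both counit laws then give the identity.
  have h2 : ι p.toBicomod (Bicomod.unit d) ≫ dropCounit p.X d ▷ d.X =
      ι p.toBicomod (Bicomod.unit d) ≫ (p.X ⊗ d.X) ◁ ε[d.X] ≫ (ρ_ _).hom := by
    rw [← compXIso_hom_lact p (Bicomod.unit d)]
    calc _ = (compXIso p (Bicomod.unit d)).hom ≫ p.X ◁ (Δ[d.X] ≫ ε[d.X] ▷ d.X ≫ (λ_ _).hom) := by
          simp only [dropCounit]; monoidal
      _ = (compXIso p (Bicomod.unit d)).hom ≫ p.X ◁ (Δ[d.X] ≫ d.X ◁ ε[d.X] ≫ (ρ_ _).hom) := by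
          rw [ComonObj.counit_comul_assoc, ComonObj.comul_counit_assoc]; simp
      _ = _ := by monoidal
  rw [compComparison_hom_hom, reassoc_of% h1, rightUnitorIso_hom, ← h2]
  simp only [dropCounit]
  monoidal


/-- The pseudo-double functor that sends an effects handler `s` to the bicomodule `s ◁ d` and a
square `γ` over `(α, β)` to `γ ◁ β`. -/
noncomputable def toBicomodFunctor (C : Type u) [Category.{v} C] [MonoidalCategory C]
    [HasEqualizers C] [TensorPreservesEqualizers C] :
    PseudoDoubleFunctor (EffHandler.double C) (Bicomod.double C) (𝟭 (Comon C)) where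
  hor s := toBicomod s
  sq σ := toBicomodSq σ
  sq_vid _ := heq_of_eq (Bicomod.Sq.ext (MonoidalCategory.id_tensorHom_id _ _))
  sq_vcomp _ _ := heq_of_eq
    (Bicomod.Sq.ext (MonoidalCategory.tensorHom_comp_tensorHom _ _ _ _).symm)
  unitIso c := unitComparison c
  unitIso_naturality f := Bicomod.Sq.hext
    ((Category.comp_id _).trans (Category.id_comp _).symm)
    ((Category.comp_id _).trans (Category.id_comp _).symm)
    ((MonoidalCategory.leftUnitor_inv_naturality f.hom).trans
      (congrArg (_ ≫ ·) (MonoidalCategory.id_tensorHom _ _).symm))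
  compIso s t := compComparison s t
  compIso_naturality σ τ := Bicomod.Sq.hext
    ((Category.comp_id _).trans (Category.id_comp _).symm)
    ((Category.comp_id _).trans (Category.id_comp _).symm) (compComparison_naturality σ τ)
  -- Both vertical boundaries are the same threefold composite of identities, so no unit law is
  -- needed here, in contrast to the unitors.
  map_assoc p q r := Bicomod.Sq.hext rfl rfl (compComparison_assoc p q r)
  map_leftUnitor p := Bicomod.Sq.hext
    ((Category.comp_id _).trans (Category.comp_id _))
    ((Category.comp_id _).trans (Category.comp_id _)) (compComparison_leftUnitor p)
  map_rightUnitor p := Bicomod.Sq.hext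
    ((Category.comp_id _).trans (Category.comp_id _))
    ((Category.comp_id _).trans (Category.comp_id _)) (compComparison_rightUnitor p)

end Functor

/-! ### Faithfulness. -/

/-- In polynomials, `s ◁ d → s` is an epimorphism when `d` is nonempty. -/
theorem dropCounit_epi (X : PolyCat.{u}) (d : Comon PolyCat.{u}) (hd : Nonempty d.X.A) :
    Epi (dropCounit X d) := by
  obtain ⟨K⟩ := hd
  refine ⟨fun {Z} f g h => PolyCat.hom_ext_app fun I => ?_⟩
  -- A lift of the universal element `⟨I, id⟩` along `X ◁ d → X`: the constant choice `K` is
  -- forgotten, and the direction at `K` named by the counit is projected away. Since a morphism is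
  -- determined by its values at universal elements, evaluating `h` at this lift suffices.
  let y : (X ⊗ d.X : PolyCat.{u}) (X.B I) := ⟨⟨I, fun _ => K⟩, fun k => k.1⟩
  exact congrArg (fun φ : X ⊗ d.X ⟶ Z => PolyCat.Hom.app φ y) h

/-- Squares are determined by their images when `s ◁ d → s` is an epimorphism. -/
theorem toBicomodSq_injective {C : Type u} [Category.{v} C] [MonoidalCategory C]
    {c d c' d' : Comon C} (s : EffHandler c d) (s' : EffHandler c' d') [Epi (dropCounit s.X d)] :
    Function.Injective (fun σ : Σ (f : c ⟶ c') (g : d ⟶ d'), Sq s s' f g =>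
      (⟨σ.1, σ.2.1, toBicomodSq σ.2.2⟩ :
        Σ (f : c ⟶ c') (g : d ⟶ d'), Bicomod.Sq s.toBicomod s'.toBicomod f g)) := by
  rintro ⟨f, g, σ⟩ ⟨f', g', τ⟩ h
  obtain ⟨hf, h⟩ := Sigma.mk.inj h
  dsimp only at hf
  subst hf
  obtain ⟨hg, h⟩ := Sigma.mk.inj (eq_of_heq h)
  dsimp only at hg
  subst hg
  have h1 : σ.hom ⊗ₘ g.hom = τ.hom ⊗ₘ g.hom := congrArg Bicomod.Sq.hom (eq_of_heq h)
  have h2 : σ = τ := Sq.ext (by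
    -- After precomposition with the epimorphism, naturality expresses each carrier map through its
    -- image under the functor, and the images agree.
    rw [← cancel_epi (dropCounit s.X d), ← dropCounit_naturality σ.hom g, h1,
      dropCounit_naturality])
  rw [h2]

/-! ### Essential image over `0` and `y`. -/

/-- A section of an invertible map is its two-sided inverse. -/
theorem dropCounit_ract_of_isIso {C : Type u} [Category.{v} C] [MonoidalCategory C]
    {c d : Comon C} (p : Bicomod c d) [IsIso (dropCounit p.X d)] :
    dropCounit p.X d ≫ p.ract = 𝟙 _ := by
  rw [← cancel_mono (dropCounit p.X d), Category.assoc, ract_dropCounit, Category.comp_id, Category.id_comp]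

/-- The counit of the trivial comonoid is an identity, so only the right unitor is left. -/
theorem isIso_dropCounit_trivial {C : Type u} [Category.{v} C] [MonoidalCategory C] (X : C) :
    IsIso (dropCounit X (Comon.trivial C)) := by
  have h : dropCounit X (Comon.trivial C) = (ρ_ X).hom := by
    rw [dropCounit]
    exact (congrArg (· ≫ _) (MonoidalCategory.whiskerLeft_id X (𝟙_ C))).trans (Category.id_comp _)
  rw [h]
  exact (ρ_ X).isIso_hom

/-- The carrier of a bicomodule over `0` on the right has no directions. -/
theorem isIso_dropCounit_emptyComon {c : Comon PolyCat.{u}}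
    (p : Bicomod c PolyCat.emptyComon.{u}) : IsIso (dropCounit p.X PolyCat.emptyComon) := by
  -- The right coaction sends `I` to a position of `p ◁ 0`, whose second component maps directions
  -- to the empty set. By the counit law its first component is `I` again, so a direction at `I`
  -- would yield an element of the empty set.
  have h (I : p.X.A) : p.X.B I → PEmpty.{u + 1} := fun i => by
    have h2 := congrArg (fun φ : p.X ⟶ p.X => PolyCat.Hom.app φ (⟨I, id⟩ : p.X (p.X.B I)))
      (ract_dropCounit p)
    have h3 : (p.ract.onPos I).1 = I := congrArg Sigma.fst h2
    exact (p.ract.onPos I).2 (cast (congrArg p.X.B h3.symm) i)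
  refine ⟨⟨fun I => ⟨I, h I⟩, fun _ k => k.1⟩, ?_, ?_⟩
  · refine PolyCat.hom_ext_app fun I => ?_
    -- A position of `p ◁ 0` is determined by its first component, because there is only one
    -- function out of an empty set of directions.
    have h1 : ∀ J : (p.X ⊗ PolyCat.emptyComon.X : PolyCat.{u}).A, J = ⟨J.1, h J.1⟩ := fun J =>
      Sigma.ext rfl (heq_of_eq (funext fun i => (h J.1 i).elim))
    refine Sigma.ext (h1 I).symm (Function.hfunext (congrArg _ (h1 I).symm) fun k => ?_)
    exact (h I.1 k.1).elim
  · rfl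

end EffHandler

/-! ### The theorem. -/

theorem mainTheorem4 :
    ∃ F : PseudoDoubleFunctor Eff.{u} CatSharp.{u} (𝟭 (Comon PolyCat.{u})),
      -- the action on horizontal morphisms and on squares
      (∀ (c d : Comon PolyCat.{u}) (s : EffHandler c d),
        F.hor (a := c) (b := d) s = s.toBicomod) ∧
      (∀ (c d c' d' : Comon PolyCat.{u}) (s : EffHandler c d) (s' : EffHandler c' d')
          (f : c ⟶ c') (g : d ⟶ d') (σ : EffHandler.Sq s s' f g),
        HEq (Bicomod.Sq.hom (F.sq (a := c) (b := d) (a' := c') (b' := d') (p := s) (p' := s')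
          (f := f) (g := g) σ)) (σ.hom ⊗ₘ g.hom)) ∧
      -- faithfulness on horizontal morphisms between nonempty categories and their squares
      (∀ c d c' d' : Comon PolyCat.{u},
        Nonempty c.X.A → Nonempty d.X.A → Nonempty c'.X.A → Nonempty d'.X.A →
        ∀ (s : EffHandler c d) (s' : EffHandler c' d'),
          Function.Injective
            (F.mapMor (a := c) (b := d) (a' := c') (b' := d') (p := s) (p' := s'))) ∧
      -- the essential image
      (∀ (c : Comon PolyCat.{u}) (p : Bicomod c PolyCat.emptyComon.{u}),
        ∃ s : EffHandler c PolyCat.emptyComon.{u},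
          Nonempty (CatSharp.{u}.GlobIso (F.hor (a := c) (b := PolyCat.emptyComon.{u}) s) p)) ∧
      (∀ (c : Comon PolyCat.{u}) (p : Bicomod c (Comon.trivial PolyCat.{u})),
        ∃ s : EffHandler c (Comon.trivial PolyCat.{u}),
          Nonempty (CatSharp.{u}.GlobIso
            (F.hor (a := c) (b := Comon.trivial PolyCat.{u}) s) p)) := by
  refine ⟨EffHandler.toBicomodFunctor PolyCat.{u}, fun _ _ _ => rfl,
    fun _ _ _ _ _ _ _ _ _ => HEq.rfl, ?_, ?_, ?_⟩
  · intro c d c' d' _ hd _ _ s s'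
    have := EffHandler.dropCounit_epi s.X d hd
    exact EffHandler.toBicomodSq_injective s s'
  · intro c p
    have := EffHandler.isIso_dropCounit_emptyComon p
    exact ⟨_, ⟨EffHandler.ofBicomodGlobIso p (EffHandler.dropCounit_ract_of_isIso p)⟩⟩
  · intro c p
    have := EffHandler.isIso_dropCounit_trivial p.X
    exact ⟨_, ⟨EffHandler.ofBicomodGlobIso p (EffHandler.dropCounit_ract_of_isIso p)⟩⟩
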